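/- Let $H=(V,E,w)$ be a finite hypergraph: $V$ is a finite set with at least two elements, $E$ is a set of non-empty subsets of $V$, and $w:E\to(0,\infty)$. Put $w_v:=\sum_{e\ni v}w_e$, $w(S):=\sum_{v\in S}w_v$, $\langle f,g\rangle_w:=\sum_v w_vf_vg_v$, and assume $w_v>0$ for every $v\in V$. Let $\partial S$ be the set of edges meeting both $S$ and $V\setminus S$, and let $$\phi(S):=\frac{w(\partial S)}{w(S)},\qquad \phi_H:=\min_{\emptyset\ne S\subsetneq V}\max\{\phi(S),\phi(V\setminus S)\}.$$ For $e\in E$ put $[e]:=e\cup\{0\}$, where $0$ is a special index that is not a vertex, and let $\beta^e_j\ge 0$ $(j\in[e])$ be constants with $\sum_{j\in[e]}\beta^e_j=1$. Diffusion rules. For $f\in\mathbb R^V$ let $S_e:=\operatorname{argmax}_{e}f$, $I_e:=\operatorname{argmin}_{e}f$, $M_e:=\max_e f$, $m_e:=\min_e f$. A vector $r\in\mathbb R^V$ obeys the rules at $f$ if there are net rates $\varphi'_u(e,j)\in\mathbb R$ of measure flowing into $u$ due to $(e,j)$ (for $e\in E$, $j\in[e]$, $u\in e$) such that * $w_ur_u=\sum_{e\ni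 u}\sum_{j\in[e]}\varphi'_u(e,j)$ for all $u\in V$; * for $u\ne j$: $\varphi'_u(e,j)<0$ implies $u\in S_e$, and $\varphi'_u(e,j)>0$ implies $u\in I_e$; * $\sum_{u\in S_e}\max(-\varphi'_u(e,0),0)=w_e\beta^e_0(M_e-m_e)=\sum_{u\in I_e}\max(\varphi'_u(e,0),0)$; * for $j\in e$: $\sum_{u\in S_e\setminus\{j\}}\max(-\varphi'_u(e,j),0)=w_e\beta^e_j(M_e-f_j)$, $\ \sum_{u\in I_e\setminus\{j\}}\max(\varphi'_u(e,j),0)=w_e\beta^e_j(f_j-m_e)$ and $\varphi'_j(e,j)=w_e\beta^e_j(M_e+m_e-2f_j)$. A diffusion process is a continuous curve $f:[0,\infty)\to\mathbb R^V$ that has at every $t\ge0$ a right derivative $\frac{df}{dt}$, which obeys the rules at $f(t)$. **Theorem.** The diffusion process defines an operator $L_wf:=-\frac{df}{dt}$ on $\mathbb R^V$: from every initial vector there is exactly one diffusion process, and there is a map $L_w:\mathbb R^V\to\mathbb R^V$ such that $\frac{df}{dt}(t)=-L_wf(t)$ for every diffusion process $f$ and every $t\ge0$. Moreover, for each $f\in\mathbb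 R^V$, $r=-L_wf$ is the only vector that obeys the rules at $f$ with rates that also satisfy, for $u\neq j$, the first-order constraints: $\varphi'_u(e,j)<0$ implies $u\in\operatorname{argmax}_{S_e}r$, and $\varphi'_u(e,j)>0$ implies $u\in\operatorname{argmin}_{I_e}r$. The smallest eigenvalue of $L_w$ is $0$, with the all-ones vector $\mathbf 1$ as an eigenvector. The operator $L_w$ has a second eigenvalue $\gamma_2$, that is, a smallest eigenvalue having an eigenvector that is not a multiple of $\mathbf 1$; it satisfies $$\gamma_2=\min_{0\ne f,\ \langle f,\mathbf 1\rangle_w=0}\frac{\langle f,L_wf\rangle_w}{\langle f,f\rangle_w}$$ and the Cheeger inequality $$\frac{\gamma_2}{2}\le\phi_H\le2\sqrt{\gamma_2}.$$ -/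

import Mathlib

open Set

namespace MediatorDiffusion

/-- A finite edge-weighted hypergraph on the vertex set `V`: a finite set of non-empty subsets of
`V`, each with a positive weight. (Values of `weight` off `edges` play no role.) -/
structure WeightedHypergraph (V : Type*) where
  edges : Finset (Finset V)
  weight : Finset V → ℝ
  edge_nonempty : ∀ e ∈ edges, e.Nonempty
  weight_pos : ∀ e ∈ edges, 0 < weight e

namespace WeightedHypergraph

variable {V : Type*} [Fintype V] [DecidableEq V] (H : WeightedHypergraph V)

/-- The weighted degree `w_v = ∑_{e ∋ v} w_e`. -/
def vertexWeight (v : V) : ℝ := ∑ e ∈ H.edges with v ∈ e, H.weight e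

/-- `w(S) = ∑_{v ∈ S} w_v`. -/
def setWeight (S : Finset V) : ℝ := ∑ v ∈ S, H.vertexWeight v

/-- `w(∂S)`, the total weight of the edges that intersect both `S` and its complement. -/
def cutWeight (S : Finset V) : ℝ :=
  ∑ e ∈ H.edges with (e ∩ S).Nonempty ∧ (e ∩ Sᶜ).Nonempty, H.weight e

/-- The conductance `φ(S) = w(∂S) / w(S)` of a set of vertices. -/
noncomputable def setConductance (S : Finset V) : ℝ := H.cutWeight S / H.setWeight S

/-- The values `max {φ(S), φ(V \ S)}` over all proper non-empty `S ⊊ V`. -/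
def conductanceValues : Set ℝ :=
  {c | ∃ S : Finset V, S.Nonempty ∧ S ≠ Finset.univ ∧
    c = max (H.setConductance S) (H.setConductance Sᶜ)}

/-- The conductance `φ_H` of the hypergraph, a minimum by `isLeast_conductance` below. -/
noncomputable def conductance : ℝ := sInf H.conductanceValues

theorem isLeast_conductance [Nontrivial V] : IsLeast H.conductanceValues H.conductance := by
  have hfin : H.conductanceValues.Finite := by
    refine (Set.finite_range fun S : Finset V =>
      max (H.setConductance S) (H.setConductance Sᶜ)).subset ?_
    rintro c ⟨S, -, -, rfl⟩
    exact ⟨S, rfl⟩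
  have hne : H.conductanceValues.Nonempty := by
    obtain ⟨a, b, hab⟩ := exists_pair_ne V
    refine ⟨_, {a}, Finset.singleton_nonempty a, ?_, rfl⟩
    intro h
    have hb : b ∈ ({a} : Finset V) := h ▸ Finset.mem_univ b
    exact hab (Finset.mem_singleton.1 hb).symm
  exact ⟨hne.csInf_mem hfin, fun c hc => csInf_le hfin.bddBelow hc⟩

/-- The weighted inner product `⟨f, g⟩_w = ∑_u w_u f_u g_u` on densities. -/
def wInner (f g : V → ℝ) : ℝ := ∑ u, H.vertexWeight u * f u * g u

/-- The Rayleigh quotient `⟨f, L f⟩_w / ⟨f, f⟩_w` of an operator on densities. -/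
noncomputable def rayleigh (L : (V → ℝ) → (V → ℝ)) (f : V → ℝ) : ℝ :=
  H.wInner f (L f) / H.wInner f f

variable {H}

/-- `max_{s ∈ e} f_s`. -/
noncomputable def maxDensity {e : Finset V} (he : e ∈ H.edges) (f : V → ℝ) : ℝ :=
  e.sup' (H.edge_nonempty e he) f

/-- `min_{i ∈ e} f_i`. -/
noncomputable def minDensity {e : Finset V} (he : e ∈ H.edges) (f : V → ℝ) : ℝ :=
  e.inf' (H.edge_nonempty e he) f

end WeightedHypergraph

open WeightedHypergraph

variable {V : Type*} [Fintype V] [DecidableEq V]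

/-- `argmax_{s ∈ A} f_s`; for an edge `e`, `argMax e f` is `S_e(f)`. -/
noncomputable def argMax (A : Finset V) (f : V → ℝ) : Finset V := {s ∈ A | ∀ u ∈ A, f u ≤ f s}

/-- `argmin_{i ∈ A} f_i`; for an edge `e`, `argMin e f` is `I_e(f)`. -/
noncomputable def argMin (A : Finset V) (f : V → ℝ) : Finset V := {i ∈ A | ∀ u ∈ A, f i ≤ f u}

/-- The index set `[e] = e ∪ {0}`; the special index `0` is `none`, a vertex `j` is `some j`. -/
def brackets (e : Finset V) : Finset (Option V) := Finset.insertNone e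

/-- The rate at which the vertices of `A` other than `j` lose measure, when `x u` is the net rate
of measure flowing into `u`. -/
noncomputable def outRate (A : Finset V) (j : Option V) (x : V → ℝ) : ℝ :=
  ∑ u ∈ A with some u ≠ j, max (-x u) 0

/-- The rate at which the vertices of `A` other than `j` gain measure, when `x u` is the net rate
of measure flowing into `u`. -/
noncomputable def inRate (A : Finset V) (j : Option V) (x : V → ℝ) : ℝ :=
  ∑ u ∈ A with some u ≠ j, max (x u) 0

/-- Non-negative mediator constants `β^e_j`, `e ∈ E`, `j ∈ [e]`, that sum to one on every edge. -/
structure IsMediator (H : WeightedHypergraph V) (β : Finset V → Option V → ℝ) : Prop where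
  nonneg : ∀ e ∈ H.edges, ∀ j ∈ brackets e, 0 ≤ β e j
  sum_eq_one : ∀ e ∈ H.edges, ∑ j ∈ brackets e, β e j = 1

/-- The rules of the diffusion process at an instant at which the density vector is `f` and its
time derivative is `r`; `x e j u` is the net rate of measure flowing into `u` due to `(e, j)`.
The rates of flow from `S_e(f)` and to `I_e(f)` count, with their sign, only the vertices other
than the mediator `j`, whose own net rate is prescribed separately. If `f` is constant on `e`, then
`S_e(f) = I_e(f) = e`, all these rates are zero and nothing flows within `e`. -/
structure Rules (H : WeightedHypergraph V) (β : Finset V → Option V → ℝ) (f r : V → ℝ)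
    (x : Finset V → Option V → V → ℝ) : Prop where
  /-- The density changes at the net rate of incoming measure divided by the weight. -/
  density : ∀ u, H.vertexWeight u * r u =
    ∑ e ∈ H.edges with u ∈ e, ∑ j ∈ brackets e, x e j u
  /-- Apart from the mediator, only vertices of maximum density lose measure. -/
  lose : ∀ e ∈ H.edges, ∀ j ∈ brackets e, ∀ u ∈ e, x e j u < 0 → some u ≠ j → u ∈ argMax e f
  /-- Apart from the mediator, only vertices of minimum density gain measure. -/
  gain : ∀ e ∈ H.edges, ∀ j ∈ brackets e, ∀ u ∈ e, 0 < x e j u → some u ≠ j → u ∈ argMin e f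
  /-- The direct flow from `S_e(f)` to `I_e(f)`. -/
  direct_out : ∀ e (he : e ∈ H.edges), outRate (argMax e f) none (x e none) =
    H.weight e * β e none * (maxDensity he f - minDensity he f)
  direct_in : ∀ e (he : e ∈ H.edges), inRate (argMin e f) none (x e none) =
    H.weight e * β e none * (maxDensity he f - minDensity he f)
  /-- The flow from `S_e(f)` to the mediator `j`. -/
  mediated_out : ∀ e (he : e ∈ H.edges), ∀ j ∈ e,
    outRate (argMax e f) (some j) (x e (some j)) =
      H.weight e * β e (some j) * (maxDensity he f - f j)
  /-- The flow from the mediator `j` to `I_e(f)`. -/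
  mediated_in : ∀ e (he : e ∈ H.edges), ∀ j ∈ e,
    inRate (argMin e f) (some j) (x e (some j)) =
      H.weight e * β e (some j) * (f j - minDensity he f)
  /-- The net rate of flow received by the mediator `j`. -/
  mediator : ∀ e (he : e ∈ H.edges), ∀ j ∈ e, x e (some j) j =
    H.weight e * β e (some j) * (maxDensity he f + minDensity he f - 2 * f j)

/-- The first-order derivative constraints: a vertex of `S_e(f)` that loses measure has the maximum
derivative among `S_e(f)`, and a vertex of `I_e(f)` that gains measure has the minimum derivative
among `I_e(f)`. -/
structure FirstOrderRules (H : WeightedHypergraph V) (f r : V → ℝ)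
    (x : Finset V → Option V → V → ℝ) : Prop where
  lose : ∀ e ∈ H.edges, ∀ j ∈ brackets e, ∀ u ∈ e, x e j u < 0 → some u ≠ j →
    u ∈ argMax (argMax e f) r
  gain : ∀ e ∈ H.edges, ∀ j ∈ brackets e, ∀ u ∈ e, 0 < x e j u → some u ≠ j →
    u ∈ argMin (argMin e f) r

/-- `F t`, `t ≥ 0`, is the density vector at time `t` of a diffusion process: it is continuous, and
at every instant it has a (right) time derivative that obeys the rules. The derivative is one-sided
because it can jump when densities meet. -/
structure IsDiffusionProcess (H : WeightedHypergraph V) (β : Finset V → Option V → ℝ)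
    (F : ℝ → V → ℝ) : Prop where
  continuousOn : ContinuousOn F (Ici 0)
  rules : ∀ t, 0 ≤ t → ∃ r x, HasDerivWithinAt F r (Ici t) t ∧ Rules H β (F t) r x

/-- `L` is the operator `L f = - df/dt` defined by the diffusion process: the process exists and is
unique from every initial density vector, its derivative at density `f` is always `-L f`, and
`-L f` is also the only derivative at `f` that obeys the rules together with their first-order
constraints. -/
structure IsDiffusionOperator (H : WeightedHypergraph V) (β : Finset V → Option V → ℝ)
    (L : (V → ℝ) → (V → ℝ)) : Prop where
  exists_process : ∀ f₀ : V → ℝ, ∃ F, IsDiffusionProcess H β F ∧ F 0 = f₀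
  unique_process : ∀ F G, IsDiffusionProcess H β F → IsDiffusionProcess H β G → F 0 = G 0 →
    ∀ t, 0 ≤ t → F t = G t
  hasDeriv : ∀ F, IsDiffusionProcess H β F →
    ∀ t, 0 ≤ t → HasDerivWithinAt F (-L (F t)) (Ici t) t
  firstOrder : ∀ f r : V → ℝ,
    (∃ x, Rules H β f r x ∧ FirstOrderRules H f r x) ↔ L f = -r

/-- `γ` is an eigenvalue of the (possibly non-linear) operator `L` with eigenvector `f`. -/
def IsEigenpair (L : (V → ℝ) → (V → ℝ)) (γ : ℝ) (f : V → ℝ) : Prop := f ≠ 0 ∧ L f = γ • f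

/-- `γ` is the second eigenvalue of `L`: the smallest eigenvalue is `0`, with the all-ones vector
as an eigenvector, and `γ` is the smallest eigenvalue that has an eigenvector which is not a
multiple of the all-ones vector. -/
structure IsSecondEigenvalue (L : (V → ℝ) → (V → ℝ)) (γ : ℝ) : Prop where
  ones : IsEigenpair L 0 (fun _ => 1)
  nonneg : ∀ c f, IsEigenpair L c f → 0 ≤ c
  isLeast : IsLeast {c | ∃ f, IsEigenpair L c f ∧ ∀ a : ℝ, f ≠ fun _ => a} γ

end MediatorDiffusion

/-! The diffusion is the gradient flow, for the weighted inner product, of the convex energy Q(f) =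
½ ∑_e w_e (β^e_0 (M_e - m_e)² + ∑_{j ∈ e} β^e_j ((M_e - f_j)² + (f_j - m_e)²)). If r obeys the rules
at f, then -r is a subgradient of Q at f (`Rules.energy_add_le`). Subgradients of a function are
monotone, so two processes never move apart, whichever admissible rates they use
(`IsSubgradientCurve.unique`).

The first-order constraints single out the shortest subgradient: r satisfies them iff ⟨-r, r⟩_w
equals the one-sided slope Q'(f; r), written `energySlope` (`Rules.firstOrderRules_iff`). Every
subgradient z has ⟨z, r⟩_w ≤ Q'(f; r), so ⟨z, r⟩_w ≤ -‖r‖²; hence z = -r as soon as z is no longer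
than r. Such an r exists by minimizing the norm over the compact convex set of ways to share the
flows among tied vertices (`exists_rules_firstOrderRules`). Explicit Euler schemes for this choice
converge to a curve satisfying an evolution variational inequality (EVI), and the right derivative
of any such curve is minus the shortest subgradient (`SatisfiesEVI.hasDerivWithinAt`). This proves
existence and also determines the derivative of every process.

For the spectrum, ⟨f, L f⟩_w = 2 Q(f) (`Rules.wInner_neg_self`) and Q is invariant under adding
constants. A minimizer of the Rayleigh quotient on the complement of 1 exists by compactness, and a
comparison of slopes shows that it is an eigenvector (`eq_neg_smul_of_minimizer`). For Cheeger's
inequality, 2Q lies between one half and the whole of ∑_e w_e (M_e - m_e)² (`energy_bounds`).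
Indicator functions give the easy half; cutting at a median, a co-area argument and Cauchy–Schwarz
give the hard half. -/

set_option linter.unusedSectionVars false

/-! ### Gradient flows of functions with a subgradient at every point. -/

namespace SubgradientFlow

open Filter Topology RealInnerProductSpace

variable {E : Type*} [NormedAddCommGroup E] [InnerProductSpace ℝ E]

/-- `z` is a subgradient of `Q` at `f`. -/
def IsSubgradient (Q : E → ℝ) (f z : E) : Prop := ∀ g, Q f + ⟪z, g - f⟫ ≤ Q g

/-- The local form of the evolution variational inequality for the gradient flow of `Q`. -/
def SatisfiesEVI (Q : E → ℝ) (F : ℝ → E) : Prop :=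
  ∀ t, 0 ≤ t → ∀ y c, Q y - Q (F t) < c →
    ∀ᶠ s in 𝓝[>] t, ‖F s - y‖ ^ 2 - ‖F t - y‖ ^ 2 ≤ 2 * c * (s - t)

/-- A curve whose right derivative is at every time the negative of a subgradient. -/
structure IsSubgradientCurve (Q : E → ℝ) (F : ℝ → E) : Prop where
  continuousOn : ContinuousOn F (Ici 0)
  deriv : ∀ t, 0 ≤ t → ∃ z, HasDerivWithinAt F (-z) (Ici t) t ∧ IsSubgradient Q (F t) z

variable {Q : E → ℝ} {L : E → E} {F G : ℝ → E}

/-- The right derivative of ‖F - y‖² at t is 2⟪z, y - F t⟫, which the subgradient inequality bounds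
by 2 (Q y - Q (F t)). -/
theorem IsSubgradientCurve.satisfiesEVI (hF : IsSubgradientCurve Q F) : SatisfiesEVI Q F := by
  intro t ht y c hc
  obtain ⟨z, hz, hsub⟩ := hF.deriv t ht
  have hd : HasDerivWithinAt (fun s => ‖F s - y‖ ^ 2) (2 * ⟪F t - y, -z⟫) (Ioi t) t :=
    ((hz.sub_const y).norm_sq).Ioi_of_Ici
  have hlt : 2 * ⟪F t - y, -z⟫ < 2 * c := by
    have h := hsub y
    have : ⟪F t - y, -z⟫ = ⟪z, y - F t⟫ := by
      rw [inner_neg_right, ← inner_neg_left, neg_sub, real_inner_comm]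
    rw [this]
    linarith
  filter_upwards [hd.limsup_slope_le' (by simp) hlt, self_mem_nhdsWithin] with s hs hts
  have hts : 0 < s - t := sub_pos.2 hts
  rw [slope_def_field, div_lt_iff₀ hts] at hs
  exact hs.le

theorem inner_sub_nonneg_of_isSubgradient {f g z y : E} (hz : IsSubgradient Q f z)
    (hy : IsSubgradient Q g y) : 0 ≤ ⟪z - y, f - g⟫ := by
  have h1 := hz g
  have h2 := hy f
  have e1 : ⟪z, g - f⟫ = -⟪z, f - g⟫ := by rw [← inner_neg_right, neg_sub]
  rw [inner_sub_left]
  linarith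

/-- By monotonicity of subgradients ‖F - G‖² has a nonpositive right derivative. -/
theorem IsSubgradientCurve.unique (hF : IsSubgradientCurve Q F) (hG : IsSubgradientCurve Q G)
    (h0 : F 0 = G 0) {t : ℝ} (ht : 0 ≤ t) : F t = G t := by
  choose! z hz hzs using hF.deriv
  choose! y hy hys using hG.deriv
  have key := image_le_of_deriv_right_le_deriv_boundary (a := 0) (b := t)
    (f := fun s => ‖F s - G s‖ ^ 2) (f' := fun s => 2 * ⟪F s - G s, -z s - -y s⟫)
    (B := fun _ => 0) (B' := fun _ => 0)
    ((((hF.continuousOn.sub hG.continuousOn).norm).pow 2).mono Icc_subset_Ici_self)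
    (fun s hs => ((hz s hs.1).sub (hy s hs.1)).norm_sq)
    (by simp [h0]) continuousOn_const (fun s _ => hasDerivWithinAt_const _ _ _)
    (fun s hs => by
      have h := inner_sub_nonneg_of_isSubgradient (hzs s hs.1) (hys s hs.1)
      have : ⟪F s - G s, -z s - -y s⟫ = -⟪z s - y s, F s - G s⟫ := by
        rw [real_inner_comm, ← inner_neg_left]; congr 1; abel
      rw [this]; linarith)
    (right_mem_Icc.2 ht)
  have : ‖F t - G t‖ = 0 := by
    have h := le_antisymm key (sq_nonneg _)
    exact pow_eq_zero_iff (two_ne_zero) |>.1 h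
  exact sub_eq_zero.1 (norm_eq_zero.1 this)

theorem IsSubgradient.norm_le {C : ℝ} (hC : 0 < C) (hQ0 : ∀ g, 0 ≤ Q g)
    (hQC : ∀ g, Q g ≤ C * ‖g‖ ^ 2) {f z : E} (hz : IsSubgradient Q f z) :
    ‖z‖ ≤ 4 * C * ‖f‖ := by
  -- Testing at f + s z gives s‖z‖² ≤ 2C‖f‖² + 2C s²‖z‖²; with s = 1/(4C) the last term is half of
  -- the left side and is absorbed.
  have h1 := hz (f + (4 * C)⁻¹ • z)
  rw [add_sub_cancel_left, real_inner_smul_right, real_inner_self_eq_norm_sq] at h1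
  have h2 := hQC (f + (4 * C)⁻¹ • z)
  have h3 : ‖f + (4 * C)⁻¹ • z‖ ^ 2 ≤ 2 * ‖f‖ ^ 2 + 2 * ((4 * C)⁻¹ * ‖z‖) ^ 2 := by
    have h := norm_add_le f ((4 * C)⁻¹ • z)
    rw [norm_smul, Real.norm_of_nonneg (by positivity)] at h
    have h' := pow_le_pow_left₀ (norm_nonneg _) h 2
    nlinarith [sq_nonneg (‖f‖ - (4 * C)⁻¹ * ‖z‖)]
  have h4 : (4 * C)⁻¹ * ‖z‖ ^ 2 ≤ C * (2 * ‖f‖ ^ 2 + 2 * ((4 * C)⁻¹ * ‖z‖) ^ 2) := by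
    have := mul_le_mul_of_nonneg_left h3 hC.le
    linarith [hQ0 f]
  have h5 : C * (2 * ‖f‖ ^ 2 + 2 * ((4 * C)⁻¹ * ‖z‖) ^ 2) =
      2 * C * ‖f‖ ^ 2 + (8 * C)⁻¹ * ‖z‖ ^ 2 := by
    field_simp; ring
  have h6 : (4 * C)⁻¹ * ‖z‖ ^ 2 = 2 * ((8 * C)⁻¹ * ‖z‖ ^ 2) := by field_simp; ring
  have h7 : (8 * C)⁻¹ * ‖z‖ ^ 2 ≤ 2 * C * ‖f‖ ^ 2 := by linarith
  rw [inv_mul_le_iff₀ (by positivity)] at h7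
  refine (sq_le_sq₀ (norm_nonneg _) (by positivity)).1 ?_
  linarith

/-- The EVI at y = F s and the subgradient at F s bound the upper derivative of ‖F τ - F s‖² by 2 ‖L
(F s)‖ ‖F τ - F s‖, so the distance from F s grows at rate at most ‖L (F s)‖. -/
theorem SatisfiesEVI.norm_sub_le (hF : SatisfiesEVI Q F) (hc : ContinuousOn F (Ici 0))
    (hsub : ∀ f, IsSubgradient Q f (L f)) {s t : ℝ} (hs : 0 ≤ s) (hst : s ≤ t) :
    ‖F t - F s‖ ≤ ‖L (F s)‖ * (t - s) := by
  have key : ∀ η > 0, ‖F t - F s‖ ≤ (‖L (F s)‖ + η) * (t - s) + η := by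
    intro η hη
    -- The slack η in the speed makes the comparison strict where the curve meets the barrier; the
    -- second η keeps the barrier positive at τ = s.
    set K := ‖L (F s)‖ + η with hK
    have hKpos : 0 < K := by positivity
    have h := image_le_of_liminf_slope_right_lt_deriv_boundary' (a := s) (b := t)
      (f := fun τ => ‖F τ - F s‖ ^ 2) (f' := fun τ => 2 * (Q (F s) - Q (F τ)))
      (B := fun τ => (K * (τ - s) + η) ^ 2) (B' := fun τ => 2 * (K * (τ - s) + η) * K)
      ?_ ?_ ?_ ?_ ?_ ?_ (right_mem_Icc.2 hst)
    · have h0 : 0 ≤ K * (t - s) + η := by nlinarith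
      exact (sq_le_sq₀ (norm_nonneg _) h0).1 h
    · exact (((hc.sub continuousOn_const).norm).pow 2).mono
        (Icc_subset_Ici_self.trans (Ici_subset_Ici.2 hs))
    · intro x hx r hr
      apply Eventually.frequently
      obtain ⟨c, hc1, hc2⟩ := exists_between (show Q (F s) - Q (F x) < r / 2 by linarith)
      filter_upwards [hF x (hs.trans hx.1) (F s) c hc1, self_mem_nhdsWithin] with z hz hxz
      have hxz : 0 < z - x := sub_pos.2 hxz
      rw [slope_def_field, div_lt_iff₀ hxz]
      nlinarith
    · simpa using sq_nonneg η
    · fun_prop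
    · intro x _
      have : HasDerivAt (fun τ => (K * (τ - s) + η) ^ 2) (2 * (K * (x - s) + η) * K) x := by
        have h1 : HasDerivAt (fun τ => K * (τ - s) + η) K x := by
          simpa using (((hasDerivAt_id x).sub_const s).const_mul K).add_const η
        simpa using h1.fun_pow 2
      exact this.hasDerivWithinAt
    · intro x hx hxe
      have h0 : 0 < K * (x - s) + η := by nlinarith [mul_nonneg hKpos.le (sub_nonneg.2 hx.1)]
      have hn : ‖F x - F s‖ = K * (x - s) + η :=
        (pow_left_inj₀ (norm_nonneg _) h0.le two_ne_zero).1 hxe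
      have h1 := hsub (F s) (F x)
      have h2 := abs_real_inner_le_norm (L (F s)) (F x - F s)
      have h3 := neg_le_of_abs_le h2
      rw [hn] at h3
      have : ‖L (F s)‖ < K := by linarith
      nlinarith
  refine le_of_forall_pos_le_add fun ε hε => ?_
  have ht : 0 ≤ t - s := sub_nonneg.2 hst
  have h := key (ε / (t - s + 1)) (by positivity)
  have e : ε / (t - s + 1) * (t - s) + ε / (t - s + 1) = ε := by field_simp
  nlinarith

/-- The difference quotients stay in the ball of radius ‖L (F s)‖. For any cluster point ρ the EVI
makes -ρ a subgradient, and the length bound forces -ρ = L (F s); with only one possible cluster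
point, compactness gives convergence. -/
theorem SatisfiesEVI.hasDerivWithinAt [FiniteDimensional ℝ E] (hF : SatisfiesEVI Q F)
    (hc : ContinuousOn F (Ici 0)) (hsub : ∀ f, IsSubgradient Q f (L f))
    (hmin : ∀ f z, IsSubgradient Q f z → ‖z‖ ≤ ‖L f‖ → z = L f) {s : ℝ} (hs : 0 ≤ s) :
    HasDerivWithinAt F (-L (F s)) (Ici s) s := by
  rw [← hasDerivWithinAt_Ioi_iff_Ici, hasDerivWithinAt_iff_tendsto_slope' (by simp)]
  have : ProperSpace E := FiniteDimensional.proper_real E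
  have hbd : ∀ᶠ t in 𝓝[>] s, slope F s t ∈ Metric.closedBall (0 : E) ‖L (F s)‖ := by
    filter_upwards [self_mem_nhdsWithin] with t hst
    have hst' : 0 < t - s := sub_pos.2 hst
    rw [mem_closedBall_zero_iff, slope_def_module, norm_smul, norm_inv, Real.norm_of_nonneg hst'.le,
      inv_mul_le_iff₀ hst', mul_comm]
    exact hF.norm_sub_le hc hsub hs (le_of_lt hst)
  refine (isCompact_closedBall (0 : E) ‖L (F s)‖).tendsto_nhds_of_unique_mapClusterPt hbd ?_
  intro ρ hρ hcl
  obtain ⟨U, hU, hlim⟩ := mapClusterPt_iff_ultrafilter.1 hcl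
  have hneg : -ρ = L (F s) := by
    refine hmin _ _ ?_ (by simpa using hρ)
    intro y
    have h1 : ∀ c, Q y - Q (F s) < c → ⟪ρ, F s - y⟫ ≤ c := by
      intro c hcQ
      refine le_of_tendsto (hlim.inner tendsto_const_nhds) ?_
      filter_upwards [hU (hF s hs y c hcQ), hU self_mem_nhdsWithin] with t ht hst
      have hst' : 0 < t - s := sub_pos.2 hst
      rw [slope_def_module, real_inner_smul_left, inv_mul_le_iff₀ hst']
      have e : F t - y = (F t - F s) + (F s - y) := by abel
      rw [e, norm_add_sq_real] at ht
      nlinarith [sq_nonneg ‖F t - F s‖]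
    have h2 : ⟪ρ, F s - y⟫ ≤ Q y - Q (F s) := le_of_forall_gt_imp_ge_of_dense h1
    have e : ⟪-ρ, y - F s⟫ = ⟪ρ, F s - y⟫ := by
      rw [inner_neg_left, ← inner_neg_right, neg_sub]
    rw [e]; linarith
  rw [← hneg, neg_neg]

/-- The explicit Euler scheme with step `h`. -/
def eulerSeq (L : E → E) (f : E) (h : ℝ) : ℕ → E
  | 0 => f
  | n + 1 => eulerSeq L f h n - h • L (eulerSeq L f h n)

theorem norm_eulerSeq_le {K : ℝ} (hL : ∀ f, ‖L f‖ ≤ K * ‖f‖) (f : E) {h : ℝ}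
    (hh : 0 ≤ h) (n : ℕ) : ‖eulerSeq L f h n‖ ≤ Real.exp (K * (h * n)) * ‖f‖ := by
  induction n with
  | zero => simp [eulerSeq]
  | succ n ih =>
    set a := eulerSeq L f h n with ha
    have h1 : ‖eulerSeq L f h (n + 1)‖ ≤ (1 + h * K) * ‖a‖ := by
      calc ‖a - h • L a‖ ≤ ‖a‖ + ‖h • L a‖ := norm_sub_le _ _
        _ = ‖a‖ + h * ‖L a‖ := by rw [norm_smul, Real.norm_of_nonneg hh]
        _ ≤ ‖a‖ + h * (K * ‖a‖) := by gcongr; exact hL a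
        _ = _ := by ring
    have h2 : 1 + h * K ≤ Real.exp (h * K) := by linarith [Real.add_one_le_exp (h * K)]
    calc _ ≤ (1 + h * K) * ‖a‖ := h1
      _ ≤ Real.exp (h * K) * (Real.exp (K * (h * n)) * ‖f‖) := by gcongr
      _ = _ := by rw [← mul_assoc, ← Real.exp_add]; push_cast; ring_nf

theorem norm_eulerSeq_sub_le {h C : ℝ} (hh : 0 ≤ h) (f : E) {m n : ℕ} (hmn : m ≤ n)
    (hC : ∀ i < n, ‖L (eulerSeq L f h i)‖ ≤ C) :
    ‖eulerSeq L f h n - eulerSeq L f h m‖ ≤ C * (h * (n - m)) := by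
  induction n, hmn using Nat.le_induction with
  | base => simp
  | succ n hmn ih =>
    have h1 := ih fun i hi => hC i (by omega)
    have h2 := hC n (by omega)
    set a := eulerSeq L f h n
    calc ‖a - h • L a - eulerSeq L f h m‖ = ‖(a - eulerSeq L f h m) - h • L a‖ := by congr 1; abel
      _ ≤ ‖a - eulerSeq L f h m‖ + ‖h • L a‖ := norm_sub_le _ _
      _ = ‖a - eulerSeq L f h m‖ + h * ‖L a‖ := by rw [norm_smul, Real.norm_of_nonneg hh]
      _ ≤ C * (h * (n - m)) + h * C := by gcongr
      _ = _ := by push_cast; ring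

/-- Expanding the square of one step leaves the subgradient term and an error h² ‖L a‖², that is, h
C² per unit of time, which disappears as h → 0. -/
theorem eulerSeq_evi (hsub : ∀ f, IsSubgradient Q f (L f)) {h C c : ℝ} (hh : 0 ≤ h) (f y : E)
    {m n : ℕ} (hmn : m ≤ n) (hC : ∀ i < n, ‖L (eulerSeq L f h i)‖ ≤ C)
    (hc : ∀ i, m ≤ i → i < n → Q y - Q (eulerSeq L f h i) ≤ c) :
    ‖eulerSeq L f h n - y‖ ^ 2 - ‖eulerSeq L f h m - y‖ ^ 2 ≤
      (2 * c + h * C ^ 2) * (h * (n - m)) := by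
  induction n, hmn using Nat.le_induction with
  | base => simp
  | succ n hmn ih =>
    have h1 := ih (fun i hi => hC i (by omega)) fun i hi hi' => hc i hi (by omega)
    have h2 := hC n (by omega)
    have h3 := hc n hmn (by omega)
    set a := eulerSeq L f h n
    have h4 := hsub a y
    have e : ‖a - h • L a - y‖ ^ 2 = ‖a - y‖ ^ 2 + 2 * h * ⟪L a, y - a⟫ + h ^ 2 * ‖L a‖ ^ 2 := by
      have e1 : a - h • L a - y = (a - y) - h • L a := by abel
      have e2 : ⟪a - y, L a⟫ = -⟪L a, y - a⟫ := by
        rw [real_inner_comm, ← inner_neg_right, neg_sub]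
      rw [e1, norm_sub_sq_real, real_inner_smul_right, e2, norm_smul, mul_pow,
        Real.norm_of_nonneg hh]
      ring
    have h5 : ‖L a‖ ^ 2 ≤ C ^ 2 := pow_le_pow_left₀ (norm_nonneg _) h2 2
    have h6 : h * ⟪L a, y - a⟫ ≤ h * c := by gcongr; linarith
    have h7 : h ^ 2 * ‖L a‖ ^ 2 ≤ h ^ 2 * C ^ 2 := by gcongr
    show ‖a - h • L a - y‖ ^ 2 - _ ≤ _
    rw [e]
    push_cast
    nlinarith

theorem exists_satisfiesEVI [FiniteDimensional ℝ E] (hQ : Continuous Q)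
    (hsub : ∀ f, IsSubgradient Q f (L f)) {K : ℝ} (hK : 0 ≤ K) (hL : ∀ f, ‖L f‖ ≤ K * ‖f‖)
    (f : E) : ∃ F : ℝ → E, F 0 = f ∧ ContinuousOn F (Ici 0) ∧ SatisfiesEVI Q F := by
  have : ProperSpace E := FiniteDimensional.proper_real E
  -- A single ultrafilter of step sizes h → 0 makes the Euler curves converge at every time at once,
  -- without extracting subsequences.
  let l : Ultrafilter ℝ := Ultrafilter.of (𝓝[>] (0 : ℝ))
  have hl : (l : Filter ℝ) ≤ 𝓝[>] 0 := Ultrafilter.of_le _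
  have hpos : ∀ᶠ h in (l : Filter ℝ), 0 < h := hl self_mem_nhdsWithin
  have hl0 : Tendsto (fun h : ℝ => h) l (𝓝 0) := hl.trans nhdsWithin_le_nhds
  let u : ℝ → ℝ → E := fun h t => eulerSeq L f h ⌊t / h⌋₊
  let R : ℝ → ℝ := fun T => Real.exp (K * T) * ‖f‖
  have hfl : ∀ {h t : ℝ}, 0 < h → 0 ≤ t → h * ⌊t / h⌋₊ ≤ t ∧ t - h ≤ h * ⌊t / h⌋₊ := by
    intro h t hh ht
    have h1 := Nat.floor_le (div_nonneg ht hh.le)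
    have h2 := Nat.lt_floor_add_one (t / h)
    rw [le_div_iff₀ hh] at h1
    rw [div_lt_iff₀ hh] at h2
    constructor <;> nlinarith
  have hbd : ∀ {h T : ℝ}, 0 < h → 0 ≤ T → ∀ i : ℕ, i ≤ ⌊T / h⌋₊ → ‖eulerSeq L f h i‖ ≤ R T := by
    intro h T hh hT i hi
    refine (norm_eulerSeq_le hL f hh.le i).trans ?_
    have h1 := (hfl hh hT).1
    have h2 : (i : ℝ) ≤ ⌊T / h⌋₊ := by exact_mod_cast hi
    have h3 : h * i ≤ T := (mul_le_mul_of_nonneg_left h2 hh.le).trans h1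
    simp only [R]
    gcongr
  have hCbd : ∀ {h T : ℝ}, 0 < h → 0 ≤ T → ∀ i : ℕ, i < ⌊T / h⌋₊ →
      ‖L (eulerSeq L f h i)‖ ≤ K * R T := fun hh hT i hi =>
    (hL _).trans (mul_le_mul_of_nonneg_left (hbd hh hT i hi.le) hK)
  have hlim : ∀ t, ∃ x, 0 ≤ t → Tendsto (fun h => u h t) l (𝓝 x) := by
    intro t
    by_cases ht : 0 ≤ t
    · obtain ⟨x, -, hx⟩ := (isCompact_closedBall (0 : E) (R t)).ultrafilter_le_nhds'
        (l.map fun h => u h t) (by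
          rw [Ultrafilter.mem_map]
          filter_upwards [hpos] with h hh
          simpa [u] using hbd hh ht _ le_rfl)
      exact ⟨x, fun _ => hx⟩
    · exact ⟨0, fun h => absurd h ht⟩
  choose F hF using hlim
  have hdiff : ∀ {h s t T : ℝ}, 0 < h → 0 ≤ s → s ≤ t → t ≤ T →
      ‖u h t - u h s‖ ≤ K * R T * (t - s + h) := by
    intro h s t T hh hs hst htT
    have hT : 0 ≤ T := hs.trans (hst.trans htT)
    have hR : 0 ≤ R T := by simp only [R]; positivity
    have hmn : ⌊s / h⌋₊ ≤ ⌊t / h⌋₊ := Nat.floor_le_floor (by gcongr)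
    have htT' : ⌊t / h⌋₊ ≤ ⌊T / h⌋₊ := Nat.floor_le_floor (by gcongr)
    refine (norm_eulerSeq_sub_le hh.le f hmn fun i hi => hCbd hh hT i (by omega)).trans ?_
    have h1 := (hfl hh (hs.trans hst)).1
    have h2 := (hfl hh hs).2
    gcongr
    linarith
  have hLip : ∀ {s t T : ℝ}, 0 ≤ s → s ≤ t → t ≤ T → ‖F t - F s‖ ≤ K * R T * (t - s) := by
    intro s t T hs hst htT
    refine le_of_tendsto_of_tendsto ((hF t (hs.trans hst)).sub (hF s hs)).norm
      (g := fun h => K * R T * (t - s + h)) ?_ ?_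
    · simpa using (tendsto_const_nhds.add hl0).const_mul (K * R T)
    · filter_upwards [hpos] with h hh using hdiff hh hs hst htT
  refine ⟨F, ?_, ?_, ?_⟩
  · refine tendsto_nhds_unique (hF 0 le_rfl) ?_
    simp [u, eulerSeq]
  · intro t ht
    have hlip : LipschitzOnWith (K * R (t + 1)).toNNReal F (Icc 0 (t + 1)) := by
      refine LipschitzOnWith.of_dist_le_mul fun x hx y hy => ?_
      have hR : 0 ≤ K * R (t + 1) := by simp only [R]; positivity
      rw [Real.coe_toNNReal _ hR, dist_eq_norm, Real.dist_eq]
      rcases le_total y x with h | h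
      · rw [abs_of_nonneg (sub_nonneg.2 h)]
        exact hLip hy.1 h hx.2
      · rw [norm_sub_rev, abs_sub_comm, abs_of_nonneg (sub_nonneg.2 h)]
        exact hLip hx.1 h hy.2
    have hcw := hlip.continuousOn t ⟨ht, by linarith⟩
    refine hcw.mono_of_mem_nhdsWithin ?_
    rw [← Ici_inter_Iic]
    exact inter_mem self_mem_nhdsWithin (mem_nhdsWithin_of_mem_nhds (Iic_mem_nhds (by linarith)))
  · intro t ht y c hc
    set C := K * R (t + 1) with hCdef
    have hC0 : 0 ≤ C := by simp only [hCdef, R]; positivity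
    have hnear : ∀ᶠ z in 𝓝 (F t), Q y - Q z < c :=
      (continuous_const.sub hQ).continuousAt.eventually_lt continuousAt_const hc
    obtain ⟨ε, hε, hball⟩ := Metric.eventually_nhds_iff.1 hnear
    -- On the time interval from t to s ≤ t + δ the Euler iterates stay within C (δ + h) of their
    -- value at t, which is itself within ε/3 of F t. So they remain in the ball where Q y - Q < c.
    obtain ⟨δ, hδ, hδC⟩ : ∃ δ > 0, C * δ < ε / 3 := by
      refine ⟨ε / 3 / (C + 1), by positivity, ?_⟩
      rw [← mul_div_assoc, div_lt_iff₀ (by positivity)]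
      nlinarith
    have hIoo : Ioo t (t + min 1 δ) ∈ 𝓝[>] t := Ioo_mem_nhdsGT (by simp [hδ])
    filter_upwards [hIoo] with s hs
    have hs1 : s ≤ t + 1 := hs.2.le.trans (by gcongr; exact min_le_left _ _)
    have hs2 : s - t ≤ δ := by linarith [hs.2, min_le_right 1 δ]
    have hst : t ≤ s := hs.1.le
    have hs0 : 0 ≤ s := ht.trans hst
    have hfloor : ∀ {r : ℝ}, 0 ≤ r → Tendsto (fun h : ℝ => h * (⌊r / h⌋₊ : ℝ)) l (𝓝 r) := by
      intro r hr
      refine tendsto_of_tendsto_of_tendsto_of_le_of_le' (g := fun h => r - h) (h := fun _ => r)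
        (by simpa using tendsto_const_nhds.sub hl0) tendsto_const_nhds ?_ ?_
      · filter_upwards [hpos] with h hh using (hfl hh hr).2
      · filter_upwards [hpos] with h hh using (hfl hh hr).1
    have hlhs : Tendsto (fun h => ‖u h s - y‖ ^ 2 - ‖u h t - y‖ ^ 2) l
        (𝓝 (‖F s - y‖ ^ 2 - ‖F t - y‖ ^ 2)) :=
      (((hF s hs0).sub_const y).norm.pow 2).sub (((hF t ht).sub_const y).norm.pow 2)
    have hrhs : Tendsto (fun h : ℝ => (2 * c + h * C ^ 2) *
        (h * (⌊s / h⌋₊ : ℝ) - h * (⌊t / h⌋₊ : ℝ))) l (𝓝 (2 * c * (s - t))) := by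
      have h1 : Tendsto (fun h : ℝ => 2 * c + h * C ^ 2) l (𝓝 (2 * c)) := by
        simpa using (hl0.mul_const (C ^ 2)).const_add (2 * c)
      exact h1.mul ((hfloor hs0).sub (hfloor ht))
    refine le_of_tendsto_of_tendsto hlhs hrhs ?_
    have hclose : ∀ᶠ h in (l : Filter ℝ), dist (u h t) (F t) < ε / 3 :=
      (hF t ht) (Metric.ball_mem_nhds _ (by positivity))
    have hsmall : ∀ᶠ h in (l : Filter ℝ), C * h < ε / 3 := by
      have : Tendsto (fun h => C * h) l (𝓝 0) := by simpa using hl0.const_mul C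
      exact this.eventually_lt_const (by positivity)
    filter_upwards [hpos, hclose, hsmall] with h hh hcl hsm
    have hmn : ⌊t / h⌋₊ ≤ ⌊s / h⌋₊ := Nat.floor_le_floor (by gcongr)
    have hsT : ⌊s / h⌋₊ ≤ ⌊(t + 1) / h⌋₊ := Nat.floor_le_floor (by gcongr)
    rw [← mul_sub]
    refine eulerSeq_evi hsub hh.le f y hmn
      (fun i hi => hCbd hh (by linarith) i (by omega)) fun i hi hi' => ?_
    have hdist : dist (eulerSeq L f h i) (F t) < ε := by
      have h1 : ‖eulerSeq L f h i - u h t‖ ≤ C * (h * (i - ⌊t / h⌋₊)) :=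
        norm_eulerSeq_sub_le hh.le f hi fun j hj => hCbd hh (by linarith) j (by omega)
      have h2 : h * i ≤ s := by
        have : (i : ℝ) ≤ ⌊s / h⌋₊ := by exact_mod_cast hi'.le
        exact (mul_le_mul_of_nonneg_left this hh.le).trans (hfl hh hs0).1
      have h3 := (hfl hh ht).2
      have h4 : C * (h * (i - ⌊t / h⌋₊)) ≤ C * (δ + h) := by
        gcongr
        linarith
      calc dist (eulerSeq L f h i) (F t) ≤ dist (eulerSeq L f h i) (u h t) + dist (u h t) (F t) :=
            dist_triangle _ _ _
        _ < ε := by rw [dist_eq_norm]; linarith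
    exact (hball hdist).le

theorem exists_isSubgradientCurve [FiniteDimensional ℝ E] (hQ : Continuous Q)
    (hsub : ∀ f, IsSubgradient Q f (L f))
    (hmin : ∀ f z, IsSubgradient Q f z → ‖z‖ ≤ ‖L f‖ → z = L f)
    {K : ℝ} (hK : 0 ≤ K) (hL : ∀ f, ‖L f‖ ≤ K * ‖f‖) (f : E) :
    ∃ F : ℝ → E, F 0 = f ∧ ContinuousOn F (Ici 0) ∧
      ∀ t, 0 ≤ t → HasDerivWithinAt F (-L (F t)) (Ici t) t := by
  obtain ⟨F, h0, hc, hF⟩ := exists_satisfiesEVI hQ hsub hK hL f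
  exact ⟨F, h0, hc, fun t ht => hF.hasDerivWithinAt hc hsub hmin ht⟩

end SubgradientFlow

/-! ### The energy, its one-sided slopes, and the flow rules as a subgradient condition. -/

namespace MediatorDiffusion

open WeightedHypergraph Filter Topology

variable {V : Type*}

/-- `max_{u ∈ e} f_u`, with value `0` for the empty set. -/
noncomputable def edgeMax (e : Finset V) (f : V → ℝ) : ℝ :=
  if he : e.Nonempty then e.sup' he f else 0

/-- `min_{u ∈ e} f_u`, with value `0` for the empty set. -/
noncomputable def edgeMin (e : Finset V) (f : V → ℝ) : ℝ :=
  if he : e.Nonempty then e.inf' he f else 0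

theorem maxDensity_eq_edgeMax {H : WeightedHypergraph V} {e : Finset V} (he : e ∈ H.edges)
    (f : V → ℝ) : maxDensity he f = edgeMax e f := by
  rw [edgeMax, dif_pos (H.edge_nonempty e he), maxDensity]

theorem minDensity_eq_edgeMin {H : WeightedHypergraph V} {e : Finset V} (he : e ∈ H.edges)
    (f : V → ℝ) : minDensity he f = edgeMin e f := by
  rw [edgeMin, dif_pos (H.edge_nonempty e he), minDensity]

theorem le_edgeMax {e : Finset V} {u : V} (hu : u ∈ e) (f : V → ℝ) : f u ≤ edgeMax e f := by
  rw [edgeMax, dif_pos ⟨u, hu⟩]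
  exact Finset.le_sup' f hu

theorem edgeMin_le {e : Finset V} {u : V} (hu : u ∈ e) (f : V → ℝ) : edgeMin e f ≤ f u := by
  rw [edgeMin, dif_pos ⟨u, hu⟩]
  exact Finset.inf'_le f hu

theorem exists_eq_edgeMax {e : Finset V} (he : e.Nonempty) (f : V → ℝ) :
    ∃ u ∈ e, f u = edgeMax e f := by
  rw [edgeMax, dif_pos he]
  obtain ⟨u, hu, h⟩ := Finset.exists_mem_eq_sup' he f
  exact ⟨u, hu, h.symm⟩

theorem exists_eq_edgeMin {e : Finset V} (he : e.Nonempty) (f : V → ℝ) :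
    ∃ u ∈ e, f u = edgeMin e f := by
  rw [edgeMin, dif_pos he]
  obtain ⟨u, hu, h⟩ := Finset.exists_mem_eq_inf' he f
  exact ⟨u, hu, h.symm⟩

theorem edgeMax_le {e : Finset V} (he : e.Nonempty) {f : V → ℝ} {a : ℝ} (h : ∀ u ∈ e, f u ≤ a) :
    edgeMax e f ≤ a := by
  obtain ⟨u, hu, hue⟩ := exists_eq_edgeMax he f
  exact hue ▸ h u hu

theorem le_edgeMin {e : Finset V} (he : e.Nonempty) {f : V → ℝ} {a : ℝ} (h : ∀ u ∈ e, a ≤ f u) :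
    a ≤ edgeMin e f := by
  obtain ⟨u, hu, hue⟩ := exists_eq_edgeMin he f
  exact hue ▸ h u hu

theorem edgeMin_le_edgeMax (e : Finset V) (f : V → ℝ) : edgeMin e f ≤ edgeMax e f := by
  by_cases he : e.Nonempty
  · obtain ⟨u, hu⟩ := he
    exact (edgeMin_le hu f).trans (le_edgeMax hu f)
  · simp [edgeMin, edgeMax, he]

theorem continuous_edgeMax (e : Finset V) : Continuous (edgeMax e) := by
  by_cases he : e.Nonempty
  · have : edgeMax e = fun f => e.sup' he fun u => f u := by
      ext f; simp [edgeMax, he]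
    rw [this]
    exact Continuous.finset_sup'_apply he fun u _ => continuous_apply u
  · have : edgeMax e = fun _ => 0 := by ext f; simp [edgeMax, he]
    rw [this]
    exact continuous_const

theorem continuous_edgeMin (e : Finset V) : Continuous (edgeMin e) := by
  by_cases he : e.Nonempty
  · have : edgeMin e = fun f => e.inf' he fun u => f u := by
      ext f; simp [edgeMin, he]
    rw [this]
    exact Continuous.finset_inf'_apply he fun u _ => continuous_apply u
  · have : edgeMin e = fun _ => 0 := by ext f; simp [edgeMin, he]
    rw [this]
    exact continuous_const

/-- The contribution of the pair `(e, j)`, `j ∈ [e]`, to the energy. -/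
noncomputable def pairEnergy (e : Finset V) (j : Option V) (f : V → ℝ) : ℝ :=
  j.elim ((edgeMax e f - edgeMin e f) ^ 2)
    fun k => (edgeMax e f - f k) ^ 2 + (f k - edgeMin e f) ^ 2

/-- Half the derivative of `pairEnergy e j` at `f` when `f` moves in the direction `v` and
the maximum and the minimum over `e` have derivatives `a` and `b`. -/
noncomputable def pairSlope (e : Finset V) (j : Option V) (f : V → ℝ) (a b : ℝ) (v : V → ℝ) : ℝ :=
  j.elim ((edgeMax e f - edgeMin e f) * (a - b))
    fun k => (edgeMax e f - f k) * (a - v k) + (f k - edgeMin e f) * (v k - b)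

theorem pairEnergy_nonneg (e : Finset V) (j : Option V) (f : V → ℝ) : 0 ≤ pairEnergy e j f := by
  cases j <;> simp only [pairEnergy, Option.elim] <;> positivity

theorem pairSlope_self (e : Finset V) (j : Option V) (f : V → ℝ) :
    pairSlope e j f (edgeMax e f) (edgeMin e f) f = pairEnergy e j f := by
  cases j <;> simp only [pairEnergy, pairSlope, Option.elim] <;> ring

theorem continuous_pairEnergy (e : Finset V) (j : Option V) : Continuous (pairEnergy e j) := by
  have h1 := continuous_edgeMax e
  have h2 := continuous_edgeMin e
  rcases j with - | k
  · exact (h1.sub h2).pow 2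
  · exact ((h1.sub (continuous_apply k)).pow 2).add (((continuous_apply k).sub h2).pow 2)

/-- Each square satisfies X² ≥ x² + 2x (X - x). The slope is taken with the finite increments of the
maximum and minimum, not with their derivatives. -/
theorem pairEnergy_add_le (e : Finset V) (j : Option V) (f g : V → ℝ) :
    pairEnergy e j f +
      2 * pairSlope e j f (edgeMax e g - edgeMax e f) (edgeMin e g - edgeMin e f) (g - f) ≤
      pairEnergy e j g := by
  rcases j with - | k
  · simp only [pairEnergy, pairSlope, Option.elim]
    nlinarith [sq_nonneg ((edgeMax e g - edgeMax e f) - (edgeMin e g - edgeMin e f))]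
  · simp only [pairEnergy, pairSlope, Option.elim, Pi.sub_apply]
    nlinarith [sq_nonneg ((edgeMax e g - edgeMax e f) - (g k - f k)),
      sq_nonneg ((g k - f k) - (edgeMin e g - edgeMin e f))]

theorem pairEnergy_le (e : Finset V) {j : Option V} (hj : j ∈ brackets e) (f : V → ℝ) :
    pairEnergy e j f ≤ (edgeMax e f - edgeMin e f) ^ 2 := by
  rcases j with - | k
  · simp [pairEnergy]
  · have hk : k ∈ e := by simpa [brackets] using hj
    simp only [pairEnergy, Option.elim]
    nlinarith [mul_nonneg (sub_nonneg.2 (le_edgeMax hk f)) (sub_nonneg.2 (edgeMin_le hk f))]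

/-- For a mediator the two differences add up to M - m, and (x + y)² ≤ 2 (x² + y²). -/
theorem le_pairEnergy (e : Finset V) (j : Option V) (f : V → ℝ) :
    (edgeMax e f - edgeMin e f) ^ 2 ≤ 2 * pairEnergy e j f := by
  rcases j with - | k
  · simp only [pairEnergy, Option.elim]
    nlinarith [sq_nonneg (edgeMax e f - edgeMin e f)]
  · simp only [pairEnergy, Option.elim]
    nlinarith [sq_nonneg ((edgeMax e f - f k) - (f k - edgeMin e f))]

theorem edgeMax_neg (e : Finset V) (f : V → ℝ) : edgeMax e (-f) = -edgeMin e f := by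
  by_cases he : e.Nonempty
  · refine le_antisymm (edgeMax_le he fun u hu => neg_le_neg (edgeMin_le hu f)) ?_
    obtain ⟨u, hu, h⟩ := exists_eq_edgeMin he f
    rw [← h]
    exact le_edgeMax hu (-f)
  · simp [edgeMin, edgeMax, he]

/-- The energy whose weighted subgradients are the admissible values of `-df/dt`. -/
noncomputable def energy (H : WeightedHypergraph V) (β : Finset V → Option V → ℝ) (f : V → ℝ) : ℝ :=
  ∑ e ∈ H.edges, ∑ j ∈ brackets e, H.weight e * (β e j * pairEnergy e j f) / 2

variable {H : WeightedHypergraph V} {β : Finset V → Option V → ℝ}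

theorem continuous_energy : Continuous (energy H β) := by
  have h := continuous_pairEnergy (V := V)
  unfold energy
  fun_prop

theorem energy_nonneg (hβ : IsMediator H β) (f : V → ℝ) : 0 ≤ energy H β f :=
  Finset.sum_nonneg fun e he => Finset.sum_nonneg fun j hj => by
    have h1 := (H.weight_pos e he).le
    have h2 := hβ.nonneg e he j hj
    have h3 := pairEnergy_nonneg e j f
    positivity

/-- The β sum to one on each edge, so the bounds for single pairs average. The gap of a factor 2 is
the price of not knowing the mediators. -/
theorem energy_bounds (hβ : IsMediator H β) (f : V → ℝ) :
    ∑ e ∈ H.edges, H.weight e * (edgeMax e f - edgeMin e f) ^ 2 ≤ 4 * energy H β f ∧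
      2 * energy H β f ≤ ∑ e ∈ H.edges, H.weight e * (edgeMax e f - edgeMin e f) ^ 2 := by
  have key : ∀ e ∈ H.edges, H.weight e * (edgeMax e f - edgeMin e f) ^ 2 =
      ∑ j ∈ brackets e, H.weight e * (β e j * (edgeMax e f - edgeMin e f) ^ 2) := by
    intro e he
    rw [← Finset.mul_sum, ← Finset.sum_mul, hβ.sum_eq_one e he, one_mul]
  rw [Finset.sum_congr rfl key, energy, Finset.mul_sum, Finset.mul_sum]
  constructor
  · refine Finset.sum_le_sum fun e he => ?_
    rw [Finset.mul_sum]
    refine Finset.sum_le_sum fun j hj => ?_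
    have h1 := (H.weight_pos e he).le
    have h2 := hβ.nonneg e he j hj
    have h3 := mul_le_mul_of_nonneg_left
      (mul_le_mul_of_nonneg_left (le_pairEnergy e j f) h2) h1
    linarith
  · refine Finset.sum_le_sum fun e he => ?_
    rw [Finset.mul_sum]
    refine Finset.sum_le_sum fun j hj => ?_
    have h1 := (H.weight_pos e he).le
    have h2 := hβ.nonneg e he j hj
    have h3 := mul_le_mul_of_nonneg_left
      (mul_le_mul_of_nonneg_left (pairEnergy_le e hj f) h2) h1
    linarith

variable [Fintype V] [DecidableEq V]

theorem mem_argMax {e : Finset V} {f : V → ℝ} {u : V} :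
    u ∈ argMax e f ↔ u ∈ e ∧ f u = edgeMax e f := by
  simp only [argMax, Finset.mem_filter]
  constructor
  · rintro ⟨hu, h⟩
    exact ⟨hu, le_antisymm (le_edgeMax hu f) (edgeMax_le ⟨u, hu⟩ h)⟩
  · rintro ⟨hu, h⟩
    exact ⟨hu, fun v hv => h ▸ le_edgeMax hv f⟩

theorem mem_argMin {e : Finset V} {f : V → ℝ} {u : V} :
    u ∈ argMin e f ↔ u ∈ e ∧ f u = edgeMin e f := by
  simp only [argMin, Finset.mem_filter]
  constructor
  · rintro ⟨hu, h⟩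
    exact ⟨hu, le_antisymm (le_edgeMin ⟨u, hu⟩ h) (edgeMin_le hu f)⟩
  · rintro ⟨hu, h⟩
    exact ⟨hu, fun v hv => h ▸ edgeMin_le hv f⟩

theorem argMax_nonempty {e : Finset V} (he : e.Nonempty) (f : V → ℝ) : (argMax e f).Nonempty := by
  obtain ⟨u, hu, h⟩ := exists_eq_edgeMax he f
  exact ⟨u, mem_argMax.2 ⟨hu, h⟩⟩

theorem argMin_nonempty {e : Finset V} (he : e.Nonempty) (f : V → ℝ) : (argMin e f).Nonempty := by
  obtain ⟨u, hu, h⟩ := exists_eq_edgeMin he f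
  exact ⟨u, mem_argMin.2 ⟨hu, h⟩⟩

/-- For small t a vertex below the maximum stays below it, and a vertex attaining it moves at most
as fast as the fastest one there. -/
theorem eventually_edgeMax_add_le {e : Finset V} (he : e.Nonempty) (f v : V → ℝ) :
    ∀ᶠ t in 𝓝[>] (0 : ℝ), edgeMax e (f + t • v) ≤ edgeMax e f + t * edgeMax (argMax e f) v := by
  have h : ∀ u ∈ e, ∀ᶠ t in 𝓝[>] (0 : ℝ),
      (f + t • v) u ≤ edgeMax e f + t * edgeMax (argMax e f) v := by
    intro u hu
    by_cases hS : u ∈ argMax e f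
    · filter_upwards [self_mem_nhdsWithin] with t ht
      have h1 := le_edgeMax hS v
      have h2 := (mem_argMax.1 hS).2
      have ht : 0 < t := ht
      simp only [Pi.add_apply, Pi.smul_apply, smul_eq_mul]
      nlinarith
    · have h1 : f u < edgeMax e f :=
        lt_of_le_of_ne (le_edgeMax hu f) fun h => hS (mem_argMax.2 ⟨hu, h⟩)
      have hc1 : ContinuousAt (fun t : ℝ => (f + t • v) u) 0 := by
        simp only [Pi.add_apply, Pi.smul_apply, smul_eq_mul]; fun_prop
      have hc2 : ContinuousAt (fun t : ℝ => edgeMax e f + t * edgeMax (argMax e f) v) 0 := by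
        fun_prop
      have := hc1.eventually_lt hc2 (by simpa using h1)
      filter_upwards [nhdsWithin_le_nhds this] with t ht using ht.le
  filter_upwards [(Filter.eventually_all_finset e).2 h] with t ht
  exact edgeMax_le he ht

theorem argMax_neg (e : Finset V) (f : V → ℝ) : argMax e (-f) = argMin e f := by
  ext u
  simp [argMax, argMin]

theorem eventually_le_edgeMin_add {e : Finset V} (he : e.Nonempty) (f v : V → ℝ) :
    ∀ᶠ t in 𝓝[>] (0 : ℝ), edgeMin e f + t * edgeMin (argMin e f) v ≤ edgeMin e (f + t • v) := by
  filter_upwards [eventually_edgeMax_add_le he (-f) (-v)] with t ht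
  rw [argMax_neg, edgeMax_neg, edgeMax_neg, smul_neg, ← neg_add, edgeMax_neg] at ht
  linarith

/-- The differences being squared are nonnegative, so upper bounds for them can be squared; the
remainder C is the square of the first-order terms. -/
theorem eventually_pairEnergy_add_le {e : Finset V} (he : e.Nonempty) {j : Option V}
    (hj : j ∈ brackets e) (f v : V → ℝ) : ∃ C, ∀ᶠ t in 𝓝[>] (0 : ℝ),
      pairEnergy e j (f + t • v) ≤ pairEnergy e j f +
        2 * t * pairSlope e j f (edgeMax (argMax e f) v) (edgeMin (argMin e f) v) v +
        t ^ 2 * C := by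
  set a := edgeMax (argMax e f) v
  set b := edgeMin (argMin e f) v
  rcases j with - | k
  · refine ⟨(a - b) ^ 2, ?_⟩
    filter_upwards [eventually_edgeMax_add_le he f v, eventually_le_edgeMin_add he f v]
      with t h1 h2
    simp only [pairEnergy, pairSlope, Option.elim]
    have h3 : (edgeMax e (f + t • v) - edgeMin e (f + t • v)) ^ 2 ≤
        (edgeMax e f - edgeMin e f + t * (a - b)) ^ 2 :=
      pow_le_pow_left₀ (sub_nonneg.2 (edgeMin_le_edgeMax _ _)) (by linarith) 2
    linarith
  · have hk : k ∈ e := by simpa [brackets] using hj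
    refine ⟨(a - v k) ^ 2 + (v k - b) ^ 2, ?_⟩
    filter_upwards [eventually_edgeMax_add_le he f v, eventually_le_edgeMin_add he f v]
      with t h1 h2
    have h5 : (f + t • v) k = f k + t * v k := by simp
    have h3 : (edgeMax e (f + t • v) - (f + t • v) k) ^ 2 ≤
        (edgeMax e f - f k + t * (a - v k)) ^ 2 :=
      pow_le_pow_left₀ (sub_nonneg.2 (le_edgeMax hk _)) (by rw [h5]; linarith) 2
    have h4 : ((f + t • v) k - edgeMin e (f + t • v)) ^ 2 ≤
        (f k - edgeMin e f + t * (v k - b)) ^ 2 :=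
      pow_le_pow_left₀ (sub_nonneg.2 (edgeMin_le hk _)) (by rw [h5]; linarith) 2
    simp only [pairEnergy, pairSlope, Option.elim]
    linarith

/-- Split y into positive and negative parts: off the mediator they live on the argmin and the
argmax, so all sums can be taken over e and compared term by term. -/
theorem sum_mul_eq_of_supported {e : Finset V} {f : V → ℝ} {j : Option V} {y : V → ℝ}
    (hl : ∀ u ∈ e, y u < 0 → some u ≠ j → u ∈ argMax e f)
    (hg : ∀ u ∈ e, 0 < y u → some u ≠ j → u ∈ argMin e f) (v : V → ℝ) (a b : ℝ) :
    outRate (argMax e f) j y * a - inRate (argMin e f) j y * b +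
        ∑ u ∈ e with some u ≠ j, y u * v u =
      ∑ u ∈ argMax e f with some u ≠ j, max (-y u) 0 * (a - v u) +
        ∑ u ∈ argMin e f with some u ≠ j, max (y u) 0 * (v u - b) := by
  have hS : ∀ c : V → ℝ, ∑ u ∈ argMax e f with some u ≠ j, max (-y u) 0 * c u =
      ∑ u ∈ e with some u ≠ j, max (-y u) 0 * c u := by
    intro c
    refine Finset.sum_subset (fun u hu => ?_) fun u hu hu' => ?_
    · simp only [Finset.mem_filter] at hu ⊢
      exact ⟨(mem_argMax.1 hu.1).1, hu.2⟩
    · simp only [Finset.mem_filter] at hu hu'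
      rw [max_eq_right, zero_mul]
      by_contra h
      exact hu' ⟨hl u hu.1 (by linarith) hu.2, hu.2⟩
  have hI : ∀ c : V → ℝ, ∑ u ∈ argMin e f with some u ≠ j, max (y u) 0 * c u =
      ∑ u ∈ e with some u ≠ j, max (y u) 0 * c u := by
    intro c
    refine Finset.sum_subset (fun u hu => ?_) fun u hu hu' => ?_
    · simp only [Finset.mem_filter] at hu ⊢
      exact ⟨(mem_argMin.1 hu.1).1, hu.2⟩
    · simp only [Finset.mem_filter] at hu hu'
      rw [max_eq_right, zero_mul]
      by_contra h
      exact hu' ⟨hg u hu.1 (by linarith) hu.2, hu.2⟩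
  rw [outRate, inRate, Finset.sum_mul, Finset.sum_mul, hS fun _ => a, hI fun _ => b,
    hS fun u => a - v u, hI fun u => v u - b,
    ← Finset.sum_sub_distrib, ← Finset.sum_add_distrib, ← Finset.sum_add_distrib]
  refine Finset.sum_congr rfl fun u _ => ?_
  rcases le_total (y u) 0 with h | h
  · rw [max_eq_right h, max_eq_left (neg_nonneg.2 h)]; ring
  · rw [max_eq_left h, max_eq_right (neg_nonpos.2 h)]; ring

variable {f r : V → ℝ} {x : Finset V → Option V → V → ℝ}

/-- The `elim` is the density at the receiving end: the minimum for the direct flow, f_k for the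
mediator k. It treats both kinds of flow at once. -/
theorem Rules.outRate_eq (h : Rules H β f r x) {e : Finset V} (he : e ∈ H.edges) {j : Option V}
    (hj : j ∈ brackets e) : outRate (argMax e f) j (x e j) =
      H.weight e * β e j * (edgeMax e f - j.elim (edgeMin e f) f) := by
  rcases j with - | k
  · simpa [maxDensity_eq_edgeMax, minDensity_eq_edgeMin] using h.direct_out e he
  · simpa [maxDensity_eq_edgeMax] using h.mediated_out e he k (by simpa [brackets] using hj)

theorem Rules.inRate_eq (h : Rules H β f r x) {e : Finset V} (he : e ∈ H.edges) {j : Option V}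
    (hj : j ∈ brackets e) : inRate (argMin e f) j (x e j) =
      H.weight e * β e j * (j.elim (edgeMax e f) f - edgeMin e f) := by
  rcases j with - | k
  · simpa [maxDensity_eq_edgeMax, minDensity_eq_edgeMin] using h.direct_in e he
  · simpa [minDensity_eq_edgeMin] using h.mediated_in e he k (by simpa [brackets] using hj)

/-- This identity carries every later comparison. The right side is a slack: it is nonnegative when
a bounds v above on the argmax and b bounds it below on the argmin, and it vanishes when flow leaves
only where v = a and arrives only where v = b. -/
theorem Rules.pairSlope_add_sum (h : Rules H β f r x) {e : Finset V} (he : e ∈ H.edges)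
    {j : Option V} (hj : j ∈ brackets e) (v : V → ℝ) (a b : ℝ) :
    H.weight e * (β e j * pairSlope e j f a b v) + ∑ u ∈ e, x e j u * v u =
      ∑ u ∈ argMax e f with some u ≠ j, max (-x e j u) 0 * (a - v u) +
        ∑ u ∈ argMin e f with some u ≠ j, max (x e j u) 0 * (v u - b) := by
  rw [← sum_mul_eq_of_supported (h.lose e he j hj) (h.gain e he j hj), h.outRate_eq he hj,
    h.inRate_eq he hj]
  rcases j with - | k
  · simp only [pairSlope, Option.elim, ne_eq, reduceCtorEq, not_false_eq_true, Finset.filter_true]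
    ring
  · have hk : k ∈ e := by simpa [brackets] using hj
    have h1 : ∑ u ∈ e, x e (some k) u * v u =
        ∑ u ∈ e with some u ≠ some k, x e (some k) u * v u + x e (some k) k * v k := by
      have : (e.filter fun u => some u ≠ some k) = e.erase k := by
        ext u; simp [and_comm]
      rw [this, Finset.sum_erase_add _ _ hk]
    rw [h1, h.mediator e he k hk, maxDensity_eq_edgeMax, minDensity_eq_edgeMin]
    simp only [pairSlope, Option.elim]
    ring

theorem Rules.neg_sum_le (h : Rules H β f r x) {e : Finset V} (he : e ∈ H.edges)
    {j : Option V} (hj : j ∈ brackets e) {v : V → ℝ} {a b : ℝ} (ha : ∀ u ∈ argMax e f, v u ≤ a)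
    (hb : ∀ u ∈ argMin e f, b ≤ v u) :
    -∑ u ∈ e, x e j u * v u ≤ H.weight e * (β e j * pairSlope e j f a b v) := by
  have key := h.pairSlope_add_sum he hj v a b
  have h1 : 0 ≤ ∑ u ∈ argMax e f with some u ≠ j, max (-x e j u) 0 * (a - v u) :=
    Finset.sum_nonneg fun u hu => mul_nonneg (le_max_right _ _)
      (sub_nonneg.2 (ha u (Finset.mem_filter.1 hu).1))
  have h2 : 0 ≤ ∑ u ∈ argMin e f with some u ≠ j, max (x e j u) 0 * (v u - b) :=
    Finset.sum_nonneg fun u hu => mul_nonneg (le_max_right _ _)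
      (sub_nonneg.2 (hb u (Finset.mem_filter.1 hu).1))
  linarith

theorem Rules.neg_sum_eq_iff (h : Rules H β f r x) {e : Finset V} (he : e ∈ H.edges)
    {j : Option V} (hj : j ∈ brackets e) {v : V → ℝ} {a b : ℝ} (ha : ∀ u ∈ argMax e f, v u ≤ a)
    (hb : ∀ u ∈ argMin e f, b ≤ v u) :
    -∑ u ∈ e, x e j u * v u = H.weight e * (β e j * pairSlope e j f a b v) ↔
      (∀ u ∈ e, x e j u < 0 → some u ≠ j → v u = a) ∧
        (∀ u ∈ e, 0 < x e j u → some u ≠ j → v u = b) := by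
  have key := h.pairSlope_add_sum he hj v a b
  have h1 : ∀ u ∈ (argMax e f).filter (fun u => some u ≠ j), 0 ≤ max (-x e j u) 0 * (a - v u) :=
    fun u hu => mul_nonneg (le_max_right _ _) (sub_nonneg.2 (ha u (Finset.mem_filter.1 hu).1))
  have h2 : ∀ u ∈ (argMin e f).filter (fun u => some u ≠ j), 0 ≤ max (x e j u) 0 * (v u - b) :=
    fun u hu => mul_nonneg (le_max_right _ _) (sub_nonneg.2 (hb u (Finset.mem_filter.1 hu).1))
  have h3 := Finset.sum_nonneg h1
  have h4 := Finset.sum_nonneg h2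
  constructor
  · intro heq
    have e1 := (Finset.sum_eq_zero_iff_of_nonneg h1).1 (by linarith)
    have e2 := (Finset.sum_eq_zero_iff_of_nonneg h2).1 (by linarith)
    constructor
    · intro u hu hx huj
      have := e1 u (Finset.mem_filter.2 ⟨h.lose e he j hj u hu hx huj, huj⟩)
      rcases mul_eq_zero.1 this with h5 | h5
      · exact absurd h5 (ne_of_gt (lt_max_of_lt_left (by linarith)))
      · linarith
    · intro u hu hx huj
      have := e2 u (Finset.mem_filter.2 ⟨h.gain e he j hj u hu hx huj, huj⟩)
      rcases mul_eq_zero.1 this with h5 | h5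
      · exact absurd h5 (ne_of_gt (lt_max_of_lt_left hx))
      · linarith
  · rintro ⟨hl, hg⟩
    have e1 : ∑ u ∈ argMax e f with some u ≠ j, max (-x e j u) 0 * (a - v u) = 0 := by
      refine Finset.sum_eq_zero fun u hu => ?_
      obtain ⟨huS, huj⟩ := Finset.mem_filter.1 hu
      rcases lt_or_ge (x e j u) 0 with h5 | h5
      · rw [hl u (mem_argMax.1 huS).1 h5 huj]; ring
      · rw [max_eq_right (by linarith), zero_mul]
    have e2 : ∑ u ∈ argMin e f with some u ≠ j, max (x e j u) 0 * (v u - b) = 0 := by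
      refine Finset.sum_eq_zero fun u hu => ?_
      obtain ⟨huS, huj⟩ := Finset.mem_filter.1 hu
      rcases lt_or_ge 0 (x e j u) with h5 | h5
      · rw [hg u (mem_argMin.1 huS).1 h5 huj]; ring
      · rw [max_eq_right (by linarith), zero_mul]
    linarith

theorem sum_vertex_edge_comm (H : WeightedHypergraph V) (F : V → Finset V → ℝ) :
    ∑ u, ∑ e ∈ H.edges with u ∈ e, F u e = ∑ e ∈ H.edges, ∑ u ∈ e, F u e := by
  simp_rw [Finset.sum_filter]
  rw [Finset.sum_comm]
  refine Finset.sum_congr rfl fun e _ => ?_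
  rw [← Finset.sum_filter, Finset.filter_mem_eq_inter, Finset.univ_inter]

theorem Rules.wInner_neg_eq (h : Rules H β f r x) (v : V → ℝ) :
    H.wInner (-r) v = ∑ e ∈ H.edges, ∑ j ∈ brackets e, -∑ u ∈ e, x e j u * v u := by
  have h1 : H.wInner (-r) v =
      ∑ u, ∑ e ∈ H.edges with u ∈ e, ∑ j ∈ brackets e, -(x e j u * v u) := by
    rw [wInner]
    refine Finset.sum_congr rfl fun u _ => ?_
    rw [Pi.neg_apply, mul_neg, h.density u, neg_mul, Finset.sum_mul, ← Finset.sum_neg_distrib]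
    refine Finset.sum_congr rfl fun e _ => ?_
    rw [Finset.sum_mul, ← Finset.sum_neg_distrib]
  rw [h1, sum_vertex_edge_comm]
  refine Finset.sum_congr rfl fun e _ => ?_
  rw [Finset.sum_comm]
  exact Finset.sum_congr rfl fun j _ => Finset.sum_neg_distrib _

/-- The derivative of the energy at `f` in the direction `v`. -/
noncomputable def energySlope (H : WeightedHypergraph V) (β : Finset V → Option V → ℝ)
    (f v : V → ℝ) : ℝ :=
  ∑ e ∈ H.edges, ∑ j ∈ brackets e, H.weight e * (β e j *
    pairSlope e j f (edgeMax (argMax e f) v) (edgeMin (argMin e f) v) v)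

/-- Take for a and b the increments of the edge maximum and minimum from f to g: where f is maximal,
g_u - f_u ≤ max g - max f, and dually at the minimum. -/
theorem Rules.energy_add_le (hβ : IsMediator H β) (h : Rules H β f r x) (g : V → ℝ) :
    energy H β f + H.wInner (-r) (g - f) ≤ energy H β g := by
  rw [h.wInner_neg_eq, energy, energy, ← Finset.sum_add_distrib]
  refine Finset.sum_le_sum fun e he => ?_
  rw [← Finset.sum_add_distrib]
  refine Finset.sum_le_sum fun j hj => ?_
  have h1 := h.neg_sum_le he hj (v := g - f) (a := edgeMax e g - edgeMax e f)
    (b := edgeMin e g - edgeMin e f)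
    (fun u hu => by
      have := mem_argMax.1 hu
      rw [Pi.sub_apply, this.2]
      exact sub_le_sub_right (le_edgeMax this.1 g) _)
    (fun u hu => by
      have := mem_argMin.1 hu
      rw [Pi.sub_apply, this.2]
      exact sub_le_sub_right (edgeMin_le this.1 g) _)
  have h2 := mul_le_mul_of_nonneg_left (mul_le_mul_of_nonneg_left (pairEnergy_add_le e j f g)
    (hβ.nonneg e he j hj)) (H.weight_pos e he).le
  linarith

/-- The slack vanishes for v = f, because flow leaves only maximal and reaches only minimal
vertices. -/
theorem Rules.wInner_neg_self (h : Rules H β f r x) : H.wInner (-r) f = 2 * energy H β f := by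
  rw [h.wInner_neg_eq, energy, Finset.mul_sum]
  refine Finset.sum_congr rfl fun e he => ?_
  rw [Finset.mul_sum]
  refine Finset.sum_congr rfl fun j hj => ?_
  rw [(h.neg_sum_eq_iff he hj (a := edgeMax e f) (b := edgeMin e f)
    (fun u hu => (mem_argMax.1 hu).2.le) (fun u hu => (mem_argMin.1 hu).2.ge)).2
    ⟨fun u hu hx huj => (mem_argMax.1 (h.lose e he j hj u hu hx huj)).2,
      fun u hu hx huj => (mem_argMin.1 (h.gain e he j hj u hu hx huj)).2⟩, pairSlope_self]
  ring

theorem Rules.wInner_neg_le (h : Rules H β f r x) (v : V → ℝ) :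
    H.wInner (-r) v ≤ energySlope H β f v := by
  rw [h.wInner_neg_eq]
  exact Finset.sum_le_sum fun e he => Finset.sum_le_sum fun j hj =>
    h.neg_sum_le he hj (fun u hu => le_edgeMax hu v) (fun u hu => edgeMin_le hu v)

/-- A sum of termwise inequalities is an equality only if every term is. The direction v need not be
the velocity r produced by the flow x; this freedom is used in the existence proof. -/
theorem Rules.firstOrderRules_iff (h : Rules H β f r x) (v : V → ℝ) :
    FirstOrderRules H f v x ↔ H.wInner (-r) v = energySlope H β f v := by
  have hle : ∀ e ∈ H.edges, ∀ j ∈ brackets e, -∑ u ∈ e, x e j u * v u ≤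
      H.weight e * (β e j *
        pairSlope e j f (edgeMax (argMax e f) v) (edgeMin (argMin e f) v) v) :=
    fun e he j hj => h.neg_sum_le he hj (fun u hu => le_edgeMax hu v) (fun u hu => edgeMin_le hu v)
  have hiff : ∀ e (he : e ∈ H.edges) j (hj : j ∈ brackets e), _ := fun e he j hj =>
    h.neg_sum_eq_iff he hj (v := v) (fun u hu => le_edgeMax hu v) (fun u hu => edgeMin_le hu v)
  rw [h.wInner_neg_eq, energySlope,
    Finset.sum_eq_sum_iff_of_le fun e he => Finset.sum_le_sum (hle e he)]
  constructor
  · intro hf e he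
    refine Finset.sum_congr rfl fun j hj => (hiff e he j hj).2 ⟨fun u hu hx huj => ?_,
      fun u hu hx huj => ?_⟩
    · exact (mem_argMax.1 (hf.lose e he j hj u hu hx huj)).2
    · exact (mem_argMin.1 (hf.gain e he j hj u hu hx huj)).2
  · intro heq
    have heq' : ∀ e (he : e ∈ H.edges) j (hj : j ∈ brackets e), _ := fun e he j hj =>
      (hiff e he j hj).1 ((Finset.sum_eq_sum_iff_of_le (hle e he)).1 (heq e he) j hj)
    exact ⟨fun e he j hj u hu hx huj =>
        mem_argMax.2 ⟨h.lose e he j hj u hu hx huj, (heq' e he j hj).1 u hu hx huj⟩,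
      fun e he j hj u hu hx huj =>
        mem_argMin.2 ⟨h.gain e he j hj u hu hx huj, (heq' e he j hj).2 u hu hx huj⟩⟩

theorem eventually_energy_add_le (hβ : IsMediator H β) (f v : V → ℝ) :
    ∃ C, ∀ᶠ t in 𝓝[>] (0 : ℝ),
      energy H β (f + t • v) ≤ energy H β f + t * energySlope H β f v + t ^ 2 * C := by
  have h : ∀ e ∈ H.edges, ∀ j ∈ brackets e, ∃ C, ∀ᶠ t in 𝓝[>] (0 : ℝ),
      pairEnergy e j (f + t • v) ≤ pairEnergy e j f +
        2 * t * pairSlope e j f (edgeMax (argMax e f) v) (edgeMin (argMin e f) v) v +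
        t ^ 2 * C :=
    fun e he j hj => eventually_pairEnergy_add_le (H.edge_nonempty e he) hj f v
  choose! C hC using h
  refine ⟨∑ e ∈ H.edges, ∑ j ∈ brackets e, H.weight e * (β e j * C e j) / 2, ?_⟩
  have hall : ∀ᶠ t in 𝓝[>] (0 : ℝ), ∀ e ∈ H.edges, ∀ j ∈ brackets e, _ :=
    (Filter.eventually_all_finset _).2 fun e he => (Filter.eventually_all_finset _).2 (hC e he)
  filter_upwards [hall] with t ht
  simp only [energy, energySlope, Finset.mul_sum, ← Finset.sum_add_distrib]
  refine Finset.sum_le_sum fun e he => Finset.sum_le_sum fun j hj => ?_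
  have h1 := mul_le_mul_of_nonneg_left (mul_le_mul_of_nonneg_left (ht e he j hj)
    (hβ.nonneg e he j hj)) (H.weight_pos e he).le
  linarith

/-- Divide by t and let t → 0. Only an upper estimate of the energy along the ray is needed, so
differentiability never enters. -/
theorem le_energySlope_of_forall_add_le (hβ : IsMediator H β) {v : V → ℝ} {c d : ℝ}
    (h : ∀ t > 0, energy H β f + t * c + t ^ 2 * d ≤ energy H β (f + t • v)) :
    c ≤ energySlope H β f v := by
  obtain ⟨C, hC⟩ := eventually_energy_add_le hβ f v
  have h1 : Tendsto (fun t : ℝ => c + t * d) (𝓝[>] 0) (𝓝 c) := by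
    have : ContinuousAt (fun t : ℝ => c + t * d) 0 := by fun_prop
    simpa using this.tendsto.mono_left nhdsWithin_le_nhds
  have h2 : Tendsto (fun t : ℝ => energySlope H β f v + t * C) (𝓝[>] 0)
      (𝓝 (energySlope H β f v)) := by
    have : ContinuousAt (fun t : ℝ => energySlope H β f v + t * C) 0 := by fun_prop
    simpa using this.tendsto.mono_left nhdsWithin_le_nhds
  refine le_of_tendsto_of_tendsto h1 h2 ?_
  filter_upwards [hC, self_mem_nhdsWithin] with t ht ht0
  have ht0 : 0 < t := ht0
  have h3 := (h t ht0).trans ht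
  have h4 : t * (c + t * d) ≤ t * (energySlope H β f v + t * C) := by linarith
  exact le_of_mul_le_mul_left h4 ht0

end MediatorDiffusion

/-! ### The velocity obeying the first-order constraints: existence, minimality, uniqueness. -/

namespace MediatorDiffusion

open WeightedHypergraph Filter Topology

namespace WeightedHypergraph

variable {V : Type*} [Fintype V] [DecidableEq V] (H : WeightedHypergraph V)

theorem wInner_comm (f g : V → ℝ) : H.wInner f g = H.wInner g f :=
  Finset.sum_congr rfl fun u _ => by ring

theorem wInner_add_left (f g h : V → ℝ) : H.wInner (f + g) h = H.wInner f h + H.wInner g h := by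
  simp only [wInner, ← Finset.sum_add_distrib, Pi.add_apply]
  exact Finset.sum_congr rfl fun u _ => by ring

theorem wInner_smul_left (c : ℝ) (f h : V → ℝ) : H.wInner (c • f) h = c * H.wInner f h := by
  simp only [wInner, Finset.mul_sum, Pi.smul_apply, smul_eq_mul]
  exact Finset.sum_congr rfl fun u _ => by ring

theorem wInner_neg_left (f h : V → ℝ) : H.wInner (-f) h = -H.wInner f h := by
  simp [wInner]

theorem wInner_sub_left (f g h : V → ℝ) : H.wInner (f - g) h = H.wInner f h - H.wInner g h := by
  rw [sub_eq_add_neg, wInner_add_left, wInner_neg_left, sub_eq_add_neg]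

theorem wInner_add_right (f g h : V → ℝ) : H.wInner f (g + h) = H.wInner f g + H.wInner f h := by
  rw [wInner_comm, wInner_add_left, H.wInner_comm g, H.wInner_comm h]

theorem wInner_smul_right (c : ℝ) (f h : V → ℝ) : H.wInner f (c • h) = c * H.wInner f h := by
  rw [wInner_comm, wInner_smul_left, wInner_comm]

theorem wInner_neg_right (f h : V → ℝ) : H.wInner f (-h) = -H.wInner f h := by
  rw [wInner_comm, wInner_neg_left, wInner_comm]

theorem wInner_sub_right (f g h : V → ℝ) : H.wInner f (g - h) = H.wInner f g - H.wInner f h := by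
  rw [wInner_comm, wInner_sub_left, H.wInner_comm g, H.wInner_comm h]

variable {H}

theorem wInner_self_nonneg (hH : ∀ v, 0 < H.vertexWeight v) (f : V → ℝ) : 0 ≤ H.wInner f f :=
  Finset.sum_nonneg fun u _ => by
    have := (hH u).le
    rw [mul_assoc]
    exact mul_nonneg this (mul_self_nonneg _)

theorem wInner_self_eq_zero (hH : ∀ v, 0 < H.vertexWeight v) {f : V → ℝ} :
    H.wInner f f = 0 ↔ f = 0 := by
  constructor
  · intro h
    have h0 : ∀ u ∈ Finset.univ, 0 ≤ H.vertexWeight u * f u * f u := fun u _ => by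
      have := (hH u).le
      rw [mul_assoc]
      exact mul_nonneg this (mul_self_nonneg _)
    have h1 := (Finset.sum_eq_zero_iff_of_nonneg h0).1 h
    ext u
    simpa [(hH u).ne'] using h1 u (Finset.mem_univ u)
  · rintro rfl
    simp [wInner]

theorem eq_of_wInner_sub_self_nonpos (hH : ∀ v, 0 < H.vertexWeight v) {f g : V → ℝ}
    (h : H.wInner (f - g) (f - g) ≤ 0) : f = g :=
  sub_eq_zero.1 ((wInner_self_eq_zero hH).1 (le_antisymm h (wInner_self_nonneg hH _)))

end WeightedHypergraph

variable {V : Type*} [Fintype V] [DecidableEq V] {H : WeightedHypergraph V}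
  {β : Finset V → Option V → ℝ} {f : V → ℝ}

/-- The net rates of flow if every vertex `u` provides the share `p e u` of all the measure that
leaves `S_e(f)` and receives the share `q e u` of all the measure that goes to `I_e(f)`. -/
noncomputable def sharedRate (H : WeightedHypergraph V) (β : Finset V → Option V → ℝ) (f : V → ℝ)
    (p q : Finset V → V → ℝ) (e : Finset V) (j : Option V) (u : V) : ℝ :=
  H.weight e * β e j * j.elim ((edgeMax e f - edgeMin e f) * (q e u - p e u))
    fun k => (edgeMax e f - f k) * ((if u = k then 1 else 0) - p e u) +
      (f k - edgeMin e f) * (q e u - if u = k then 1 else 0)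

/-- The density derivative that results from `sharedRate`. -/
noncomputable def sharedVelocity (H : WeightedHypergraph V) (β : Finset V → Option V → ℝ)
    (f : V → ℝ) (p q : Finset V → V → ℝ) (u : V) : ℝ :=
  (∑ e ∈ H.edges with u ∈ e, ∑ j ∈ brackets e, sharedRate H β f p q e j u) / H.vertexWeight u

/-- Families of probability vectors supported, for every edge `e`, on `A e`. -/
def shares (H : WeightedHypergraph V) (A : Finset V → Finset V) : Set (Finset V → V → ℝ) :=
  {p | ∀ e, p e ∈ stdSimplex ℝ V ∧ (e ∈ H.edges → ∀ u ∉ A e, p e u = 0)}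

/-- The simplex condition holds for every finite set, edge or not, so all coordinates are bounded.
-/
theorem isCompact_shares (A : Finset V → Finset V) : IsCompact (shares H A) := by
  have hsub : shares H A = (univ.pi fun _ => stdSimplex ℝ V) ∩
      ⋂ e : Finset V, ⋂ (_ : e ∈ H.edges), ⋂ u : V, ⋂ (_ : u ∉ A e), {p | p e u = 0} := by
    ext p
    simp only [shares, mem_ofPred_eq, mem_inter_iff, mem_univ_pi, mem_iInter]
    exact forall_and
  rw [hsub]
  refine (isCompact_univ_pi fun _ => isCompact_stdSimplex ℝ V).inter_right ?_
  refine isClosed_iInter fun e => isClosed_iInter fun _ => isClosed_iInter fun u =>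
    isClosed_iInter fun _ => isClosed_eq (by fun_prop) continuous_const

theorem convex_shares (A : Finset V → Finset V) : Convex ℝ (shares H A) := by
  intro p hp q hq a b ha hb hab e
  refine ⟨convex_stdSimplex ℝ V (hp e).1 (hq e).1 ha hb hab, fun he u hu => ?_⟩
  simp [(hp e).2 he u hu, (hq e).2 he u hu]

theorem single_mem_shares {A : Finset V → Finset V} {s : Finset V → V}
    (hs : ∀ e ∈ H.edges, s e ∈ A e) : (fun e => Pi.single (s e) 1) ∈ shares H A := by
  intro e
  refine ⟨single_mem_stdSimplex ℝ (s e), fun he u hu => ?_⟩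
  have hne : u ≠ s e := by
    rintro rfl
    exact hu (hs e he)
  exact Pi.single_eq_of_ne hne _

section SharedRate

variable {p q : Finset V → V → ℝ}

theorem edgeMax_sub_mul_eq_zero (hp : p ∈ shares H fun e => argMax e f) {e : Finset V}
    (he : e ∈ H.edges) (u : V) : (edgeMax e f - f u) * p e u = 0 := by
  by_cases hu : u ∈ argMax e f
  · rw [(mem_argMax.1 hu).2, sub_self, zero_mul]
  · rw [(hp e).2 he u hu, mul_zero]

theorem sub_edgeMin_mul_eq_zero (hq : q ∈ shares H fun e => argMin e f) {e : Finset V}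
    (he : e ∈ H.edges) (u : V) : (f u - edgeMin e f) * q e u = 0 := by
  by_cases hu : u ∈ argMin e f
  · rw [(mem_argMin.1 hu).2, sub_self, zero_mul]
  · rw [(hq e).2 he u hu, mul_zero]

/-- The incoming term vanishes: a maximal vertex with a nonzero share q is also minimal, and then f
is constant on e. -/
theorem sharedRate_eq_of_mem_argMax (hq : q ∈ shares H fun e => argMin e f)
    {e : Finset V} (he : e ∈ H.edges) {j : Option V} (hj : j ∈ brackets e) {u : V}
    (hu : u ∈ argMax e f) (huj : some u ≠ j) : sharedRate H β f p q e j u =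
      -(H.weight e * β e j * (edgeMax e f - j.elim (edgeMin e f) f) * p e u) := by
  have h0 : (edgeMax e f - edgeMin e f) * q e u = 0 := by
    rw [← (mem_argMax.1 hu).2]; exact sub_edgeMin_mul_eq_zero hq he u
  rcases j with - | k
  · simp only [sharedRate, Option.elim]
    linear_combination H.weight e * β e none * h0
  · have hk : k ∈ e := by simpa [brackets] using hj
    have huk : u ≠ k := fun h => huj (by rw [h])
    have h1 : (f k - edgeMin e f) * q e u = 0 := by
      rcases mul_eq_zero.1 h0 with h | h
      · have : f k - edgeMin e f = 0 := by linarith [le_edgeMax hk f, edgeMin_le hk f]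
        rw [this, zero_mul]
      · rw [h, mul_zero]
    simp only [sharedRate, Option.elim, huk, if_false]
    linear_combination H.weight e * β e (some k) * h1

theorem sharedRate_eq_of_mem_argMin (hp : p ∈ shares H fun e => argMax e f)
    {e : Finset V} (he : e ∈ H.edges) {j : Option V} (hj : j ∈ brackets e) {u : V}
    (hu : u ∈ argMin e f) (huj : some u ≠ j) : sharedRate H β f p q e j u =
      H.weight e * β e j * (j.elim (edgeMax e f) f - edgeMin e f) * q e u := by
  have h0 : (edgeMax e f - edgeMin e f) * p e u = 0 := by
    rw [← (mem_argMin.1 hu).2]; exact edgeMax_sub_mul_eq_zero hp he u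
  rcases j with - | k
  · simp only [sharedRate, Option.elim]
    linear_combination -(H.weight e * β e none * h0)
  · have hk : k ∈ e := by simpa [brackets] using hj
    have huk : u ≠ k := fun h => huj (by rw [h])
    have h1 : (edgeMax e f - f k) * p e u = 0 := by
      rcases mul_eq_zero.1 h0 with h | h
      · have : edgeMax e f - f k = 0 := by linarith [le_edgeMax hk f, edgeMin_le hk f]
        rw [this, zero_mul]
      · rw [h, mul_zero]
    simp only [sharedRate, Option.elim, huk, if_false]
    linear_combination -(H.weight e * β e (some k) * h1)

theorem outCapacity_nonneg (hβ : IsMediator H β) {e : Finset V} (he : e ∈ H.edges) {j : Option V}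
    (hj : j ∈ brackets e) :
    0 ≤ H.weight e * β e j * (edgeMax e f - j.elim (edgeMin e f) f) := by
  refine mul_nonneg (mul_nonneg (H.weight_pos e he).le (hβ.nonneg e he j hj)) (sub_nonneg.2 ?_)
  rcases j with - | k
  · exact edgeMin_le_edgeMax e f
  · exact le_edgeMax (by simpa [brackets] using hj) f

theorem inCapacity_nonneg (hβ : IsMediator H β) {e : Finset V} (he : e ∈ H.edges) {j : Option V}
    (hj : j ∈ brackets e) :
    0 ≤ H.weight e * β e j * (j.elim (edgeMax e f) f - edgeMin e f) := by
  refine mul_nonneg (mul_nonneg (H.weight_pos e he).le (hβ.nonneg e he j hj)) (sub_nonneg.2 ?_)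
  rcases j with - | k
  · exact edgeMin_le_edgeMax e f
  · exact edgeMin_le (by simpa [brackets] using hj) f

theorem ne_zero_of_sharedRate_neg (hβ : IsMediator H β)
    (hq : q ∈ shares H fun e => argMin e f) {e : Finset V} (he : e ∈ H.edges) {j : Option V}
    (hj : j ∈ brackets e) {u : V} (huj : some u ≠ j) (h : sharedRate H β f p q e j u < 0) :
    p e u ≠ 0 := by
  intro h0
  refine absurd h (not_lt.2 ?_)
  have h1 := (hq e).1.1 u
  have h2 := mul_nonneg (inCapacity_nonneg (f := f) hβ he hj) h1
  rcases j with - | k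
  · simp only [sharedRate, Option.elim, h0, sub_zero] at h2 ⊢
    linarith
  · have huk : u ≠ k := fun h => huj (by rw [h])
    simp only [sharedRate, Option.elim, h0, huk, if_false, sub_zero, mul_zero, zero_add] at h2 ⊢
    linarith

theorem ne_zero_of_sharedRate_pos (hβ : IsMediator H β)
    (hp : p ∈ shares H fun e => argMax e f) {e : Finset V} (he : e ∈ H.edges) {j : Option V}
    (hj : j ∈ brackets e) {u : V} (huj : some u ≠ j) (h : 0 < sharedRate H β f p q e j u) :
    q e u ≠ 0 := by
  intro h0
  refine absurd h (not_lt.2 ?_)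
  have h1 := (hp e).1.1 u
  have h2 := mul_nonneg (outCapacity_nonneg (f := f) hβ he hj) h1
  rcases j with - | k
  · simp only [sharedRate, Option.elim, h0, zero_sub] at h2 ⊢
    linarith
  · have huk : u ≠ k := fun h => huj (by rw [h])
    simp only [sharedRate, Option.elim, h0, huk, if_false, sub_zero, mul_zero, zero_sub,
      add_zero] at h2 ⊢
    linarith

theorem outRate_sharedRate (hβ : IsMediator H β) (hp : p ∈ shares H fun e => argMax e f)
    (hq : q ∈ shares H fun e => argMin e f) {e : Finset V} (he : e ∈ H.edges) {j : Option V}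
    (hj : j ∈ brackets e) : outRate (argMax e f) j (sharedRate H β f p q e j) =
      H.weight e * β e j * (edgeMax e f - j.elim (edgeMin e f) f) := by
  set c := H.weight e * β e j * (edgeMax e f - j.elim (edgeMin e f) f) with hc
  have hc0 : 0 ≤ c := outCapacity_nonneg hβ he hj
  calc outRate (argMax e f) j (sharedRate H β f p q e j)
      = ∑ u ∈ argMax e f with some u ≠ j, c * p e u := by
        refine Finset.sum_congr rfl fun u hu => ?_
        obtain ⟨huS, huj⟩ := Finset.mem_filter.1 hu
        rw [sharedRate_eq_of_mem_argMax hq he hj huS huj, neg_neg]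
        exact max_eq_left (mul_nonneg hc0 ((hp e).1.1 u))
    _ = ∑ u, c * p e u := by
        refine Finset.sum_subset (Finset.subset_univ _) fun u _ hu => ?_
        -- The sum omits only the mediator, whose share carries no flow since (M - f_u) p_u = 0, and
        -- vertices outside the argmax, whose share is zero.
        by_cases huS : u ∈ argMax e f
        · have huj : j = some u := by
            by_contra h
            exact hu (Finset.mem_filter.2 ⟨huS, fun h' => h h'.symm⟩)
          rw [hc, huj]
          simp only [Option.elim]
          linear_combination H.weight e * β e (some u) * edgeMax_sub_mul_eq_zero hp he u
        · rw [(hp e).2 he u huS, mul_zero]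
    _ = c := by rw [← Finset.mul_sum, (hp e).1.2, mul_one]

theorem inRate_sharedRate (hβ : IsMediator H β) (hp : p ∈ shares H fun e => argMax e f)
    (hq : q ∈ shares H fun e => argMin e f) {e : Finset V} (he : e ∈ H.edges) {j : Option V}
    (hj : j ∈ brackets e) : inRate (argMin e f) j (sharedRate H β f p q e j) =
      H.weight e * β e j * (j.elim (edgeMax e f) f - edgeMin e f) := by
  set c := H.weight e * β e j * (j.elim (edgeMax e f) f - edgeMin e f) with hc
  have hc0 : 0 ≤ c := inCapacity_nonneg hβ he hj
  calc inRate (argMin e f) j (sharedRate H β f p q e j)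
      = ∑ u ∈ argMin e f with some u ≠ j, c * q e u := by
        refine Finset.sum_congr rfl fun u hu => ?_
        obtain ⟨huS, huj⟩ := Finset.mem_filter.1 hu
        rw [sharedRate_eq_of_mem_argMin hp he hj huS huj]
        exact max_eq_left (mul_nonneg hc0 ((hq e).1.1 u))
    _ = ∑ u, c * q e u := by
        refine Finset.sum_subset (Finset.subset_univ _) fun u _ hu => ?_
        by_cases huS : u ∈ argMin e f
        · have huj : j = some u := by
            by_contra h
            exact hu (Finset.mem_filter.2 ⟨huS, fun h' => h h'.symm⟩)
          rw [hc, huj]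
          simp only [Option.elim]
          linear_combination H.weight e * β e (some u) * sub_edgeMin_mul_eq_zero hq he u
        · rw [(hq e).2 he u huS, mul_zero]
    _ = c := by rw [← Finset.mul_sum, (hq e).1.2, mul_one]

theorem rules_sharedRate (hH : ∀ v, 0 < H.vertexWeight v) (hβ : IsMediator H β)
    (hp : p ∈ shares H fun e => argMax e f) (hq : q ∈ shares H fun e => argMin e f) :
    Rules H β f (sharedVelocity H β f p q) (sharedRate H β f p q) where
  density u := mul_div_cancel₀ _ (hH u).ne'
  lose e he j hj u _ h huj := by
    by_contra hu
    exact ne_zero_of_sharedRate_neg hβ hq he hj huj h ((hp e).2 he u hu)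
  gain e he j hj u _ h huj := by
    by_contra hu
    exact ne_zero_of_sharedRate_pos hβ hp he hj huj h ((hq e).2 he u hu)
  direct_out e he := by
    rw [outRate_sharedRate hβ hp hq he (by simp [brackets]), maxDensity_eq_edgeMax,
      minDensity_eq_edgeMin, Option.elim]
  direct_in e he := by
    rw [inRate_sharedRate hβ hp hq he (by simp [brackets]), maxDensity_eq_edgeMax,
      minDensity_eq_edgeMin, Option.elim]
  mediated_out e he j hj := by
    rw [outRate_sharedRate hβ hp hq he (by simpa [brackets] using hj), maxDensity_eq_edgeMax,
      Option.elim]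
  mediated_in e he j hj := by
    rw [inRate_sharedRate hβ hp hq he (by simpa [brackets] using hj), minDensity_eq_edgeMin,
      Option.elim]
  mediator e he j hj := by
    have h1 := edgeMax_sub_mul_eq_zero hp he j
    have h2 := sub_edgeMin_mul_eq_zero hq he j
    rw [maxDensity_eq_edgeMax, minDensity_eq_edgeMin]
    simp only [sharedRate, Option.elim, if_true]
    linear_combination H.weight e * β e (some j) * (h2 - h1)

/-- The rates are affine in the shares but not linear, because of the mediator's indicator terms;
hence a + b = 1. -/
theorem sharedVelocity_combo (f : V → ℝ) (p q p' q' : Finset V → V → ℝ) {a b : ℝ}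
    (hab : a + b = 1) : sharedVelocity H β f (a • p + b • p') (a • q + b • q') =
      a • sharedVelocity H β f p q + b • sharedVelocity H β f p' q' := by
  have h : ∀ e j u, sharedRate H β f (a • p + b • p') (a • q + b • q') e j u =
      a * sharedRate H β f p q e j u + b * sharedRate H β f p' q' e j u := by
    intro e j u
    obtain rfl : a = 1 - b := by linarith
    rcases j with - | k <;>
      simp only [sharedRate, Option.elim, Pi.add_apply, Pi.smul_apply, smul_eq_mul] <;> ring
  ext u
  simp only [sharedVelocity, h, Finset.sum_add_distrib, ← Finset.mul_sum, Pi.add_apply,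
    Pi.smul_apply, smul_eq_mul]
  ring

end SharedRate

theorem continuous_sharedVelocity (f : V → ℝ) :
    Continuous fun θ : (Finset V → V → ℝ) × (Finset V → V → ℝ) =>
      sharedVelocity H β f θ.1 θ.2 := by
  refine continuous_pi fun u => ?_
  unfold sharedVelocity
  refine Continuous.div_const (continuous_finsetSum _ fun e _ =>
    continuous_finsetSum _ fun j _ => ?_) _
  rcases j with - | k <;> simp only [sharedRate, Option.elim] <;> fun_prop

/-- For a prescribed direction v, let a single v-maximal vertex of the argmax provide everything and
a single v-minimal vertex of the argmin receive everything. -/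
theorem exists_shares_firstOrderRules [Nonempty V] (hβ : IsMediator H β) (f v : V → ℝ) :
    ∃ p ∈ shares H (fun e => argMax e f), ∃ q ∈ shares H (fun e => argMin e f),
      FirstOrderRules H f v (sharedRate H β f p q) := by
  have h1 : ∀ e, ∃ s, e ∈ H.edges → s ∈ argMax (argMax e f) v := by
    intro e
    by_cases he : e ∈ H.edges
    · obtain ⟨s, hs⟩ := argMax_nonempty (argMax_nonempty (H.edge_nonempty e he) f) v
      exact ⟨s, fun _ => hs⟩
    · exact ⟨Classical.arbitrary V, fun h => absurd h he⟩
  have h2 : ∀ e, ∃ s, e ∈ H.edges → s ∈ argMin (argMin e f) v := by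
    intro e
    by_cases he : e ∈ H.edges
    · obtain ⟨s, hs⟩ := argMin_nonempty (argMin_nonempty (H.edge_nonempty e he) f) v
      exact ⟨s, fun _ => hs⟩
    · exact ⟨Classical.arbitrary V, fun h => absurd h he⟩
  choose s hs using h1
  choose i hi using h2
  have hp := single_mem_shares (H := H) (A := fun e => argMax e f) (s := s)
    fun e he => (mem_argMax.1 (hs e he)).1
  have hq := single_mem_shares (H := H) (A := fun e => argMin e f) (s := i)
    fun e he => (mem_argMin.1 (hi e he)).1
  refine ⟨_, hp, _, hq, ⟨fun e he j hj u _ h huj => ?_, fun e he j hj u _ h huj => ?_⟩⟩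
  · have hu : u = s e := by
      by_contra hne
      exact ne_zero_of_sharedRate_neg hβ hq he hj huj h (Pi.single_eq_of_ne hne _)
    exact hu ▸ hs e he
  · have hu : u = i e := by
      by_contra hne
      exact ne_zero_of_sharedRate_pos hβ hp he hj huj h (Pi.single_eq_of_ne hne _)
    exact hu ▸ hi e he

/-- Some density derivative obeys the rules with their first-order constraints: the one of least
weighted norm. -/
theorem exists_rules_firstOrderRules [Nonempty V] (hH : ∀ v, 0 < H.vertexWeight v)
    (hβ : IsMediator H β) (f : V → ℝ) :
    ∃ r x, Rules H β f r x ∧ FirstOrderRules H f r x := by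
  let K := shares H (fun e => argMax e f) ×ˢ shares H (fun e => argMin e f)
  have hK : IsCompact K := (isCompact_shares _).prod (isCompact_shares _)
  have hne : K.Nonempty := by
    obtain ⟨p, hp, q, hq, -⟩ := exists_shares_firstOrderRules hβ f f
    exact ⟨(p, q), hp, hq⟩
  have hcont : Continuous fun θ : (Finset V → V → ℝ) × (Finset V → V → ℝ) =>
      H.wInner (sharedVelocity H β f θ.1 θ.2) (sharedVelocity H β f θ.1 θ.2) := by
    have h := continuous_sharedVelocity (H := H) (β := β) f
    unfold wInner
    fun_prop
  obtain ⟨⟨p, q⟩, ⟨hp, hq⟩, hmin⟩ := hK.exists_isMinOn hne hcont.continuousOn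
  set r := sharedVelocity H β f p q with hr
  have hrules : Rules H β f r (sharedRate H β f p q) := rules_sharedRate hH hβ hp hq
  refine ⟨r, sharedRate H β f p q, hrules, (hrules.firstOrderRules_iff r).2 ?_⟩
  -- Compare the shortest velocity r with an r' satisfying the constraints in the direction r.
  -- Minimality gives ⟨r, r⟩ ≤ ⟨r', r⟩, hence Q'(f; r) = ⟨-r', r⟩ ≤ ⟨-r, r⟩.
  obtain ⟨p', hp', q', hq', hfo⟩ := exists_shares_firstOrderRules hβ f r
  set r' := sharedVelocity H β f p' q' with hr'
  have hrules' : Rules H β f r' (sharedRate H β f p' q') := rules_sharedRate hH hβ hp' hq'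
  have heq := (hrules'.firstOrderRules_iff r).1 hfo
  refine le_antisymm (hrules.wInner_neg_le r) ?_
  rw [← heq, H.wInner_neg_left, H.wInner_neg_left, neg_le_neg_iff]
  -- First variation of the squared norm along the segment from (p, q) to (p', q').
  have key : ∀ t : ℝ, 0 < t → t ≤ 1 →
      0 ≤ 2 * (H.wInner r' r - H.wInner r r) + t * H.wInner (r' - r) (r' - r) := by
    intro t ht ht1
    have h1 := hmin (show ((1 - t) • p + t • p', (1 - t) • q + t • q') ∈ K from
      ⟨convex_shares _ hp hp' (by linarith) ht.le (by ring),
        convex_shares _ hq hq' (by linarith) ht.le (by ring)⟩)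
    simp only [mem_ofPred_eq] at h1
    rw [sharedVelocity_combo f p q p' q' (show (1 - t) + t = 1 by ring), ← hr, ← hr'] at h1
    simp only [wInner_add_left, wInner_add_right, wInner_smul_left, wInner_smul_right,
      wInner_sub_left, wInner_sub_right, H.wInner_comm r r'] at h1 ⊢
    have h2 : 0 ≤ t * (2 * (H.wInner r' r - H.wInner r r) +
      t * (H.wInner r' r' - H.wInner r' r - (H.wInner r' r - H.wInner r r))) := by linarith
    exact nonneg_of_mul_nonneg_right h2 ht
  have hlim : Tendsto (fun t : ℝ => 2 * (H.wInner r' r - H.wInner r r) +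
      t * H.wInner (r' - r) (r' - r)) (𝓝[>] 0) (𝓝 (2 * (H.wInner r' r - H.wInner r r))) := by
    have : ContinuousAt (fun t : ℝ => 2 * (H.wInner r' r - H.wInner r r) +
      t * H.wInner (r' - r) (r' - r)) 0 := by fun_prop
    simpa using this.tendsto.mono_left nhdsWithin_le_nhds
  have := ge_of_tendsto hlim (by
    filter_upwards [Ioc_mem_nhdsGT (show (0 : ℝ) < 1 by norm_num)] with t ht
      using key t ht.1 ht.2)
  linarith

/-- A weighted subgradient of the energy at `f` that is no longer than a derivative `r` obeying
the rules and the first-order constraints equals `-r`. -/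
theorem eq_neg_of_subgradient (hH : ∀ v, 0 < H.vertexWeight v) (hβ : IsMediator H β)
    {r z : V → ℝ} {x : Finset V → Option V → V → ℝ} (hr : Rules H β f r x)
    (hfo : FirstOrderRules H f r x)
    (hz : ∀ g, energy H β f + H.wInner z (g - f) ≤ energy H β g)
    (hle : H.wInner z z ≤ H.wInner r r) : z = -r := by
  have h1 : H.wInner z r ≤ energySlope H β f r := by
    refine le_energySlope_of_forall_add_le hβ (d := 0) fun t _ => ?_
    have := hz (f + t • r)
    rw [add_sub_cancel_left, wInner_smul_right] at this
    linarith
  rw [← (hr.firstOrderRules_iff r).1 hfo] at h1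
  -- Now ⟨z, r⟩ ≤ -‖r‖², so ‖z + r‖² = ‖z‖² + 2⟨z, r⟩ + ‖r‖² ≤ 0.
  refine eq_of_wInner_sub_self_nonpos hH ?_
  simp only [wInner_sub_left, wInner_sub_right, wInner_neg_left, wInner_neg_right,
    H.wInner_comm r z] at h1 ⊢
  linarith

/-- Using each velocity as a direction for the other gives ‖r‖² ≤ ⟨r, r'⟩ and ‖r'‖² ≤ ⟨r, r'⟩, so ‖r
- r'‖² ≤ 0. -/
theorem firstOrderRules_unique (hH : ∀ v, 0 < H.vertexWeight v)
    {r r' : V → ℝ} {x x' : Finset V → Option V → V → ℝ} (hr : Rules H β f r x)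
    (hfo : FirstOrderRules H f r x) (hr' : Rules H β f r' x') (hfo' : FirstOrderRules H f r' x') :
    r = r' := by
  have h1 := hr'.wInner_neg_le r
  have h2 := hr.wInner_neg_le r'
  rw [← (hr.firstOrderRules_iff r).1 hfo] at h1
  rw [← (hr'.firstOrderRules_iff r').1 hfo'] at h2
  refine eq_of_wInner_sub_self_nonpos hH ?_
  simp only [wInner_sub_left, wInner_sub_right, wInner_neg_left, H.wInner_comm r' r] at h1 h2 ⊢
  linarith

end MediatorDiffusion

/-! ### Rayleigh quotients and the second eigenvalue. -/

namespace MediatorDiffusion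

open WeightedHypergraph Filter Topology

variable {V : Type*}

theorem edgeMax_add_const {e : Finset V} (he : e.Nonempty) (f : V → ℝ) (c : ℝ) :
    edgeMax e (fun u => f u + c) = edgeMax e f + c := by
  refine le_antisymm (edgeMax_le he fun u hu => by linarith [le_edgeMax hu f]) ?_
  obtain ⟨u, hu, h⟩ := exists_eq_edgeMax he f
  rw [← h]
  exact le_edgeMax hu fun u => f u + c

theorem edgeMin_add_const {e : Finset V} (he : e.Nonempty) (f : V → ℝ) (c : ℝ) :
    edgeMin e (fun u => f u + c) = edgeMin e f + c := by
  refine le_antisymm ?_ (le_edgeMin he fun u hu => by linarith [edgeMin_le hu f])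
  obtain ⟨u, hu, h⟩ := exists_eq_edgeMin he f
  rw [← h]
  exact edgeMin_le hu fun u => f u + c

theorem edgeMax_smul {e : Finset V} (he : e.Nonempty) (f : V → ℝ) {c : ℝ} (hc : 0 ≤ c) :
    edgeMax e (c • f) = c * edgeMax e f := by
  refine le_antisymm (edgeMax_le he fun u hu => mul_le_mul_of_nonneg_left (le_edgeMax hu f) hc) ?_
  obtain ⟨u, hu, h⟩ := exists_eq_edgeMax he f
  rw [← h]
  exact le_edgeMax hu (c • f)

theorem edgeMin_smul {e : Finset V} (he : e.Nonempty) (f : V → ℝ) {c : ℝ} (hc : 0 ≤ c) :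
    edgeMin e (c • f) = c * edgeMin e f := by
  refine le_antisymm ?_ (le_edgeMin he fun u hu => mul_le_mul_of_nonneg_left (edgeMin_le hu f) hc)
  obtain ⟨u, hu, h⟩ := exists_eq_edgeMin he f
  rw [← h]
  exact edgeMin_le hu (c • f)

variable {H : WeightedHypergraph V} {β : Finset V → Option V → ℝ}

theorem energy_add_const (f : V → ℝ) (c : ℝ) :
    energy H β (fun u => f u + c) = energy H β f := by
  refine Finset.sum_congr rfl fun e he => Finset.sum_congr rfl fun j _ => ?_
  have h : pairEnergy e j (fun u => f u + c) = pairEnergy e j f := by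
    rcases j with - | k <;> simp only [pairEnergy, Option.elim,
      edgeMax_add_const (H.edge_nonempty e he), edgeMin_add_const (H.edge_nonempty e he)] <;> ring
  rw [h]

theorem energy_smul (f : V → ℝ) {c : ℝ} (hc : 0 ≤ c) :
    energy H β (c • f) = c ^ 2 * energy H β f := by
  simp only [energy, Finset.mul_sum]
  refine Finset.sum_congr rfl fun e he => Finset.sum_congr rfl fun j _ => ?_
  have h : pairEnergy e j (c • f) = c ^ 2 * pairEnergy e j f := by
    rcases j with - | k <;> simp only [pairEnergy, Option.elim, Pi.smul_apply, smul_eq_mul,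
      edgeMax_smul (H.edge_nonempty e he) f hc, edgeMin_smul (H.edge_nonempty e he) f hc] <;> ring
  rw [h]
  ring

/-- The sum over the edges of the weighted squares of the oscillation. -/
noncomputable def oscillation (H : WeightedHypergraph V) (f : V → ℝ) : ℝ :=
  ∑ e ∈ H.edges, H.weight e * (edgeMax e f - edgeMin e f) ^ 2

theorem oscillation_nonneg (f : V → ℝ) : 0 ≤ oscillation H f :=
  Finset.sum_nonneg fun e he => mul_nonneg (H.weight_pos e he).le (sq_nonneg _)

variable [Fintype V] [DecidableEq V]

theorem sum_weight_sum_eq (H : WeightedHypergraph V) (k : V → ℝ) :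
    ∑ e ∈ H.edges, H.weight e * ∑ u ∈ e, k u = ∑ u, H.vertexWeight u * k u := by
  simp_rw [vertexWeight, Finset.sum_mul, Finset.mul_sum]
  exact (sum_vertex_edge_comm H fun u e => H.weight e * k u).symm

theorem wInner_self_eq (H : WeightedHypergraph V) (f : V → ℝ) :
    H.wInner f f = ∑ u, H.vertexWeight u * f u ^ 2 :=
  Finset.sum_congr rfl fun u _ => by ring

theorem energy_le (hβ : IsMediator H β) (f : V → ℝ) : energy H β f ≤ 2 * H.wInner f f := by
  have h1 := (energy_bounds hβ f).2
  have h2 : ∑ e ∈ H.edges, H.weight e * (edgeMax e f - edgeMin e f) ^ 2 ≤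
      ∑ e ∈ H.edges, H.weight e * ∑ u ∈ e, 4 * f u ^ 2 := by
    refine Finset.sum_le_sum fun e he => mul_le_mul_of_nonneg_left ?_ (H.weight_pos e he).le
    obtain ⟨s, hs, hs'⟩ := exists_eq_edgeMax (H.edge_nonempty e he) f
    obtain ⟨i, hi, hi'⟩ := exists_eq_edgeMin (H.edge_nonempty e he) f
    -- The factor 4, instead of 2, allows s = i: each of 2 f_s² and 2 f_i² is bounded by half of the
    -- sum.
    have e1 := Finset.single_le_sum (f := fun u => 4 * f u ^ 2) (fun u _ => by positivity) hs
    have e2 := Finset.single_le_sum (f := fun u => 4 * f u ^ 2) (fun u _ => by positivity) hi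
    rw [← hs', ← hi']
    nlinarith [sq_nonneg (f s + f i)]
  rw [sum_weight_sum_eq] at h2
  rw [wInner_self_eq, Finset.mul_sum]
  have h3 : ∑ u, H.vertexWeight u * (4 * f u ^ 2) =
      2 * ∑ u, 2 * (H.vertexWeight u * f u ^ 2) := by
    rw [Finset.mul_sum]; exact Finset.sum_congr rfl fun u _ => by ring
  linarith

/-- Conservation of mass: the energy is constant along 1, so a subgradient has no component there.
-/
theorem Rules.wInner_one (hβ : IsMediator H β) {f r : V → ℝ} {x : Finset V → Option V → V → ℝ}
    (h : Rules H β f r x) : H.wInner r (fun _ => 1) = 0 := by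
  have key : ∀ c : ℝ, c * H.wInner (-r) (fun _ => 1) ≤ 0 := by
    intro c
    have h1 := h.energy_add_le hβ (fun u => f u + c)
    rw [energy_add_const] at h1
    have h2 : (fun u => f u + c) - f = c • fun _ => (1 : ℝ) := by ext u; simp
    rw [h2, wInner_smul_right] at h1
    linarith
  have h1 := key 1
  have h2 := key (-1)
  rw [wInner_neg_left] at h1 h2
  linarith

theorem wInner_one_one_pos [Nonempty V] (hH : ∀ v, 0 < H.vertexWeight v) :
    0 < H.wInner (fun _ => 1) (fun _ => 1) := by
  refine lt_of_le_of_ne (wInner_self_nonneg hH _) fun h => ?_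
  have := congrFun ((wInner_self_eq_zero hH).1 h.symm) (Classical.arbitrary V)
  simp at this

/-- The least Rayleigh quotient over the vectors orthogonal to `1` is attained. -/
theorem exists_energy_minimizer [Nontrivial V] (hH : ∀ v, 0 < H.vertexWeight v) :
    ∃ f : V → ℝ, f ≠ 0 ∧ H.wInner f (fun _ => 1) = 0 ∧
      ∀ g, H.wInner g (fun _ => 1) = 0 →
        2 * energy H β f / H.wInner f f * H.wInner g g ≤ 2 * energy H β g := by
  let K : Set (V → ℝ) := {f | H.wInner f (fun _ => 1) = 0 ∧ H.wInner f f = 1}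
  have hc1 : Continuous fun f : V → ℝ => H.wInner f (fun _ => 1) := by unfold wInner; fun_prop
  have hc2 : Continuous fun f : V → ℝ => H.wInner f f := by unfold wInner; fun_prop
  have hscale : ∀ g : V → ℝ, g ≠ 0 → H.wInner g (fun _ => 1) = 0 →
      (√(H.wInner g g))⁻¹ • g ∈ K := by
    intro g hg hg1
    have hpos : 0 < H.wInner g g :=
      lt_of_le_of_ne (wInner_self_nonneg hH g) fun h => hg ((wInner_self_eq_zero hH).1 h.symm)
    refine ⟨by rw [wInner_smul_left, hg1, mul_zero], ?_⟩
    rw [wInner_smul_left, wInner_smul_right, ← mul_assoc, ← mul_inv, Real.mul_self_sqrt hpos.le,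
      inv_mul_cancel₀ hpos.ne']
  have hne : K.Nonempty := by
    obtain ⟨a, b, hab⟩ := exists_pair_ne V
    -- The values w_b at a and -w_a at b have weighted sum zero.
    refine ⟨_, hscale (Pi.single a (H.vertexWeight b) - Pi.single b (H.vertexWeight a)) ?_ ?_⟩
    · intro h
      have := congrFun h a
      simp [hab, (hH b).ne'] at this
    · rw [wInner_sub_left]
      simp [wInner, Pi.single_apply, mul_comm]
  have hK : IsCompact K := by
    refine Metric.isCompact_of_isClosed_isBounded
      ((isClosed_eq hc1 continuous_const).inter (isClosed_eq hc2 continuous_const)) ?_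
    obtain ⟨v₀, -, hv₀⟩ := Finset.exists_min_image Finset.univ H.vertexWeight Finset.univ_nonempty
    refine (Metric.isBounded_closedBall (x := (0 : V → ℝ))
      (r := √(H.vertexWeight v₀)⁻¹)).subset fun f hf => ?_
    rw [mem_closedBall_zero_iff, pi_norm_le_iff_of_nonneg (Real.sqrt_nonneg _)]
    intro u
    rw [Real.norm_eq_abs]
    refine Real.abs_le_sqrt ?_
    have h1 : H.vertexWeight u * f u ^ 2 ≤ 1 := by
      rw [← hf.2, wInner_self_eq]
      exact Finset.single_le_sum (f := fun u => H.vertexWeight u * f u ^ 2)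
        (fun u _ => mul_nonneg (hH u).le (sq_nonneg _)) (Finset.mem_univ u)
    have h2 : H.vertexWeight v₀ * f u ^ 2 ≤ 1 :=
      (mul_le_mul_of_nonneg_right (hv₀ u (Finset.mem_univ u)) (sq_nonneg _)).trans h1
    rwa [← one_div, le_div_iff₀' (hH v₀)]
  obtain ⟨f, hf, hmin⟩ := hK.exists_isMinOn hne (continuous_energy (β := β)).continuousOn
  refine ⟨f, fun h => ?_, hf.1, fun g hg => ?_⟩
  · have := hf.2
    rw [h] at this
    simp [wInner] at this
  · by_cases hg0 : g = 0
    · subst hg0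
      have h0 : energy H β (0 : V → ℝ) = 0 := by
        simpa using energy_smul (H := H) (β := β) (0 : V → ℝ) le_rfl
      simp [wInner, h0]
    · have hpos : 0 < H.wInner g g :=
        lt_of_le_of_ne (wInner_self_nonneg hH g) fun h => hg0 ((wInner_self_eq_zero hH).1 h.symm)
      have h1 : energy H β f ≤ energy H β ((√(H.wInner g g))⁻¹ • g) := hmin (hscale g hg0 hg)
      rw [energy_smul _ (inv_nonneg.2 (Real.sqrt_nonneg _)), inv_pow, Real.sq_sqrt hpos.le,
        inv_mul_eq_div, le_div_iff₀ hpos] at h1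
      rw [hf.2]
      linarith

/-- Subtract the weighted mean: the energy does not change and the squared norm becomes the
variance. -/
theorem le_energy_of_forall_orthogonal [Nonempty V] (hH : ∀ v, 0 < H.vertexWeight v) {γ : ℝ}
    (hγ : ∀ g, H.wInner g (fun _ => 1) = 0 → γ * H.wInner g g ≤ 2 * energy H β g) (g : V → ℝ) :
    γ * (H.wInner g g - H.wInner g (fun _ => 1) ^ 2 / H.wInner (fun _ => 1) (fun _ => 1)) ≤
      2 * energy H β g := by
  have hW := wInner_one_one_pos hH
  set W := H.wInner (fun _ => 1) (fun _ => 1) with hWdef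
  set c := H.wInner g (fun _ => 1) with hc
  have e1 : (fun u => g u + -(c / W)) = g - (c / W) • fun _ => (1 : ℝ) := by
    ext u; simp [sub_eq_add_neg]
  have h1 := hγ (fun u => g u + -(c / W)) (by
    rw [e1, wInner_sub_left, wInner_smul_left, ← hc, ← hWdef, div_mul_cancel₀ _ hW.ne', sub_self])
  rw [energy_add_const, e1] at h1
  simp only [wInner_sub_left, wInner_sub_right, wInner_smul_left, wInner_smul_right,
    H.wInner_comm (fun _ => 1) g, ← hc, ← hWdef] at h1
  have e2 : H.wInner g g - c / W * c - c / W * (c - c / W * W) = H.wInner g g - c ^ 2 / W := by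
    field_simp; ring
  rw [← e2]
  exact h1

/-- The lower bound by γ times the variance is attained at f, so comparing slopes in the direction r
gives γ⟨f, r⟩ ≤ Q'(f; r) = -‖r‖². With ⟨-r, f⟩ = γ‖f‖² this yields ‖r + γ f‖² ≤ 0. -/
theorem eq_neg_smul_of_minimizer [Nonempty V] (hH : ∀ v, 0 < H.vertexWeight v)
    (hβ : IsMediator H β) {γ : ℝ}
    (hγ : ∀ g, H.wInner g (fun _ => 1) = 0 → γ * H.wInner g g ≤ 2 * energy H β g)
    {f r : V → ℝ} {x : Finset V → Option V → V → ℝ} (hr : Rules H β f r x)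
    (hfo : FirstOrderRules H f r x) (hf : H.wInner f (fun _ => 1) = 0)
    (hfγ : 2 * energy H β f = γ * H.wInner f f) : r = -(γ • f) := by
  have hW := wInner_one_one_pos hH
  have h1 : γ * H.wInner f r ≤ energySlope H β f r := by
    refine le_energySlope_of_forall_add_le hβ (d := γ / 2 * (H.wInner r r -
      H.wInner r (fun _ => 1) ^ 2 / H.wInner (fun _ => 1) (fun _ => 1))) fun t _ => ?_
    have h := le_energy_of_forall_orthogonal hH hγ (f + t • r)
    simp only [wInner_add_left, wInner_add_right, wInner_smul_left, wInner_smul_right, hf,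
      H.wInner_comm r f, zero_add] at h
    rw [mul_pow, mul_div_assoc] at h
    linarith
  rw [← (hr.firstOrderRules_iff r).1 hfo] at h1
  have h2 := hr.wInner_neg_self
  rw [hfγ] at h2
  refine eq_of_wInner_sub_self_nonpos hH ?_
  simp only [wInner_sub_left, wInner_sub_right, wInner_neg_left, wInner_neg_right,
    wInner_smul_left, wInner_smul_right, H.wInner_comm f r] at h1 h2 ⊢
  have h3 : γ * H.wInner r f = -(γ * (γ * H.wInner f f)) := by rw [← h2]; ring
  linarith

theorem rules_zero_of_const (H : WeightedHypergraph V) (β : Finset V → Option V → ℝ) (c : ℝ) :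
    Rules H β (fun _ => c) 0 (fun _ _ _ => 0) ∧
      FirstOrderRules H (fun _ => c) 0 (fun _ _ _ => 0) := by
  have hM : ∀ e (he : e ∈ H.edges), maxDensity he (fun _ => c) = c := fun e he => by
    simp [maxDensity]
  have hm : ∀ e (he : e ∈ H.edges), minDensity he (fun _ => c) = c := fun e he => by
    simp [minDensity]
  constructor
  · constructor <;> intros <;> simp_all [outRate, inRate]
    exact Or.inr (by ring)
  · constructor <;> intros <;> simp_all

/-! ### Conductance and Cheeger's inequality. -/

theorem setWeight_add_compl (S : Finset V) :
    H.setWeight S + H.setWeight Sᶜ = H.setWeight Finset.univ :=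
  Finset.sum_add_sum_compl S _

theorem setWeight_mono (hH : ∀ v, 0 < H.vertexWeight v) {S T : Finset V} (h : S ⊆ T) :
    H.setWeight S ≤ H.setWeight T :=
  Finset.sum_le_sum_of_subset_of_nonneg h fun v _ _ => (hH v).le

theorem setWeight_pos (hH : ∀ v, 0 < H.vertexWeight v) {S : Finset V} (h : S.Nonempty) :
    0 < H.setWeight S :=
  Finset.sum_pos (fun v _ => hH v) h

theorem cutWeight_compl (S : Finset V) : H.cutWeight Sᶜ = H.cutWeight S := by
  simp only [cutWeight, compl_compl, and_comm]

theorem cutWeight_nonneg (S : Finset V) : 0 ≤ H.cutWeight S :=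
  Finset.sum_nonneg fun e he => (H.weight_pos e (Finset.mem_filter.1 he).1).le

theorem wInner_one_one : H.wInner (fun _ => 1) (fun _ => 1) = H.setWeight Finset.univ := by
  simp [wInner, setWeight]

theorem oscillation_indicator (S : Finset V) :
    oscillation H (fun u => if u ∈ S then 1 else 0) = H.cutWeight S := by
  rw [oscillation, cutWeight, Finset.sum_filter]
  refine Finset.sum_congr rfl fun e he => ?_
  set k : V → ℝ := fun u => if u ∈ S then 1 else 0 with hk
  have hne := H.edge_nonempty e he
  have hle : edgeMax e k ≤ 1 := edgeMax_le hne fun u _ => by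
    simp only [hk]; split_ifs <;> norm_num
  have hge : 0 ≤ edgeMin e k := le_edgeMin hne fun u _ => by
    simp only [hk]; split_ifs <;> norm_num
  have hmM := edgeMin_le_edgeMax e k
  split_ifs with hcut
  · obtain ⟨⟨a, ha⟩, ⟨b, hb⟩⟩ := hcut
    simp only [Finset.mem_inter, Finset.mem_compl] at ha hb
    have h1 := le_edgeMax ha.1 k
    have h2 := edgeMin_le hb.1 k
    simp only [hk, ha.2, hb.2, if_true, if_false] at h1 h2
    rw [show edgeMax e k = 1 from le_antisymm hle h1, show edgeMin e k = 0 from le_antisymm h2 hge]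
    ring
  · have hconst : ∃ c, ∀ u ∈ e, k u = c := by
      by_cases h : (e ∩ S).Nonempty
      · refine ⟨1, fun u hu => if_pos ?_⟩
        by_contra huS
        exact hcut ⟨h, u, Finset.mem_inter.2 ⟨hu, Finset.mem_compl.2 huS⟩⟩
      · exact ⟨0, fun u hu => if_neg fun huS => h ⟨u, Finset.mem_inter.2 ⟨hu, huS⟩⟩⟩
    obtain ⟨c, hc⟩ := hconst
    have h1 := edgeMax_le hne fun u hu => (hc u hu).le
    have h2 := le_edgeMin hne fun u hu => (hc u hu).ge
    rw [show edgeMax e k - edgeMin e k = 0 by linarith]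
    ring

/-- The easy half of Cheeger's inequality. -/
theorem half_le_conductance [Nontrivial V] (hH : ∀ v, 0 < H.vertexWeight v)
    (hβ : IsMediator H β) {γ : ℝ} (hγ0 : 0 ≤ γ)
    (hγ : ∀ g, H.wInner g (fun _ => 1) = 0 → γ * H.wInner g g ≤ 2 * energy H β g) :
    γ / 2 ≤ H.conductance := by
  obtain ⟨S, hS, hSu, hc⟩ := H.isLeast_conductance.1
  have hSc : Sᶜ.Nonempty := by
    rw [Finset.nonempty_iff_ne_empty]
    exact fun h => hSu (Finset.compl_eq_empty_iff S |>.1 h)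
  have ha := setWeight_pos hH hS
  have hb := setWeight_pos hH hSc
  have hW := setWeight_add_compl (H := H) S
  -- The indicator of S has variance ab/(a + b) ≥ min(a, b)/2, where a and b are the weights of S
  -- and its complement.
  have h1 := le_energy_of_forall_orthogonal hH hγ (fun u => if u ∈ S then 1 else 0)
  have h2 := (energy_bounds hβ (fun u => if u ∈ S then 1 else 0)).2
  rw [← oscillation, oscillation_indicator] at h2
  have e1 : H.wInner (fun u => if u ∈ S then 1 else 0) (fun u => if u ∈ S then 1 else 0) =
      H.setWeight S := by
    simp [wInner, setWeight, Finset.sum_ite_mem]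
  have e2 : H.wInner (fun u => if u ∈ S then 1 else 0) (fun _ => 1) = H.setWeight S := by
    simp [wInner, setWeight, Finset.sum_ite_mem]
  rw [e1, e2, wInner_one_one, ← hW] at h1
  rw [hc, setConductance, setConductance, cutWeight_compl]
  set a := H.setWeight S
  set b := H.setWeight Sᶜ
  have h3 : γ * (a - a ^ 2 / (a + b)) ≤ H.cutWeight S := h1.trans h2
  have e3 : a - a ^ 2 / (a + b) = a * b / (a + b) := by field_simp; ring
  rw [e3] at h3
  rcases le_total a b with hab | hab
  · refine le_max_of_le_left ?_
    rw [le_div_iff₀ ha]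
    refine le_trans ?_ h3
    rw [mul_div_assoc, div_mul_eq_mul_div, mul_div_assoc]
    refine mul_le_mul_of_nonneg_left ?_ hγ0
    rw [← mul_div_assoc, div_le_div_iff₀ two_pos (by linarith)]
    nlinarith
  · refine le_max_of_le_right ?_
    rw [le_div_iff₀ hb]
    refine le_trans ?_ h3
    rw [mul_div_assoc, div_mul_eq_mul_div, mul_div_assoc]
    refine mul_le_mul_of_nonneg_left ?_ hγ0
    rw [← mul_div_assoc, div_le_div_iff₀ two_pos (by linarith)]
    nlinarith

/-- A co-area inequality: an isoperimetric inequality for the subsets of `T` gives a Poincaré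
inequality for the non-negative functions supported on `T`. -/
theorem mul_sum_le_of_isoperimetric {φ : ℝ} {T : Finset V}
    (hφ : ∀ S ⊆ T, S.Nonempty → φ * H.setWeight S ≤ H.cutWeight S) (k : V → ℝ)
    (hk : ∀ u, 0 ≤ k u) (hkT : ∀ u ∉ T, k u = 0) :
    φ * ∑ u, H.vertexWeight u * k u ≤
      ∑ e ∈ H.edges, H.weight e * (edgeMax e k - edgeMin e k) := by
  -- Induct on the size of the support S, subtracting from k on S its least value a there; this
  -- removes at least one vertex from the support.
  induction hn : (Finset.univ.filter fun u => k u ≠ 0).card using Nat.strong_induction_on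
    generalizing k with
  | _ n ih =>
  set S := Finset.univ.filter fun u => k u ≠ 0 with hS
  have hmem : ∀ u, u ∈ S ↔ k u ≠ 0 := fun u => by simp [hS]
  rcases S.eq_empty_or_nonempty with h0 | hne
  · have hk0 : ∀ u, k u = 0 := fun u => by
      by_contra h
      exact Finset.notMem_empty u (h0 ▸ (hmem u).2 h)
    simp only [hk0, mul_zero, Finset.sum_const_zero]
    exact Finset.sum_nonneg fun e he =>
      mul_nonneg (H.weight_pos e he).le (sub_nonneg.2 (edgeMin_le_edgeMax e k))
  obtain ⟨u₀, hu₀, ha⟩ := exists_eq_edgeMin hne k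
  set a := edgeMin S k
  have hapos : 0 < a := ha ▸ lt_of_le_of_ne (hk u₀) ((hmem u₀).1 hu₀).symm
  have hale : ∀ u ∈ S, a ≤ k u := fun u hu => edgeMin_le hu k
  set k' : V → ℝ := fun u => k u - if u ∈ S then a else 0 with hk'
  have hk'S : ∀ u ∈ S, k' u = k u - a := fun u hu => by simp [hk', hu]
  have hk'n : ∀ u ∉ S, k' u = 0 := fun u hu => by
    have : k u = 0 := by
      by_contra h
      exact hu ((hmem u).2 h)
    simp [hk', hu, this]
  have hkn : ∀ u ∉ S, k u = 0 := fun u hu => by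
    by_contra h
    exact hu ((hmem u).2 h)
  have hk'0 : ∀ u, 0 ≤ k' u := fun u => by
    by_cases hu : u ∈ S
    · rw [hk'S u hu]; linarith [hale u hu]
    · rw [hk'n u hu]
  have hlt : (Finset.univ.filter fun u => k' u ≠ 0).card < n := by
    rw [← hn]
    refine Finset.card_lt_card (Finset.ssubset_iff_of_subset (fun u hu => ?_) |>.2
      ⟨u₀, hu₀, fun hu => ?_⟩)
    · by_contra h
      exact (Finset.mem_filter.1 hu).2 (hk'n u h)
    · exact (Finset.mem_filter.1 hu).2 (by rw [hk'S u₀ hu₀, ha, sub_self])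
  have hST : S ⊆ T := fun u hu => by
    by_contra h
    exact (hmem u).1 hu (hkT u h)
  have hind := ih _ hlt k' hk'0 (fun u hu => hk'n u fun h => hu (hST h)) rfl
  have hsum : ∑ u, H.vertexWeight u * k u =
      ∑ u, H.vertexWeight u * k' u + a * H.setWeight S := by
    have : a * H.setWeight S = ∑ u, H.vertexWeight u * if u ∈ S then a else 0 := by
      simp [setWeight, Finset.sum_mul, Finset.sum_ite_mem, mul_comm a]
    rw [this, ← Finset.sum_add_distrib]
    exact Finset.sum_congr rfl fun u _ => by simp only [hk']; ring
  -- On an edge cut by S the minimum of k is zero and the subtraction lowers the maximum by at least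
  -- a; on the other edges the oscillation is unchanged.
  have hedge : ∑ e ∈ H.edges, H.weight e * (edgeMax e k' - edgeMin e k') + a * H.cutWeight S ≤
      ∑ e ∈ H.edges, H.weight e * (edgeMax e k - edgeMin e k) := by
    rw [cutWeight, Finset.sum_filter, Finset.mul_sum, ← Finset.sum_add_distrib]
    refine Finset.sum_le_sum fun e he => ?_
    have hw := H.weight_pos e he
    have hene := H.edge_nonempty e he
    obtain ⟨s, hs, hsM⟩ := exists_eq_edgeMax hene k'
    obtain ⟨i, hi, him⟩ := exists_eq_edgeMin hene k'
    have hsk := le_edgeMax hs k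
    have hik := edgeMin_le hi k
    split_ifs with hcut
    · obtain ⟨⟨b, hb⟩, ⟨d, hd⟩⟩ := hcut
      simp only [Finset.mem_inter, Finset.mem_compl] at hb hd
      have h1 : edgeMax e k' + a ≤ edgeMax e k := by
        by_cases hsS : s ∈ S
        · have := hk'S s hsS; linarith
        · have := hk'n s hsS
          linarith [hale b hb.2, le_edgeMax hb.1 k]
      have h2 : edgeMin e k ≤ edgeMin e k' := by
        linarith [edgeMin_le hd.1 k, hkn d hd.2, hk'0 i]
      nlinarith
    · have h1 : edgeMax e k' - edgeMin e k' ≤ edgeMax e k - edgeMin e k := by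
        by_cases h : (e ∩ S).Nonempty
        · have hsub : ∀ u ∈ e, u ∈ S := fun u hu => by
            by_contra huS
            exact hcut ⟨h, u, Finset.mem_inter.2 ⟨hu, Finset.mem_compl.2 huS⟩⟩
          linarith [hk'S s (hsub s hs), hk'S i (hsub i hi)]
        · have hsub : ∀ u ∈ e, u ∉ S := fun u hu huS => h ⟨u, Finset.mem_inter.2 ⟨hu, huS⟩⟩
          linarith [hk'n s (hsub s hs), hk'n i (hsub i hi), hkn s (hsub s hs), hkn i (hsub i hi)]
      nlinarith
  have hiso := mul_le_mul_of_nonneg_left (hφ S hST hne) hapos.le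
  rw [hsum]
  linarith

theorem conductance_nonneg [Nontrivial V] (hH : ∀ v, 0 < H.vertexWeight v) :
    0 ≤ H.conductance := by
  obtain ⟨S, hS, -, hc⟩ := H.isLeast_conductance.1
  rw [hc]
  exact le_max_of_le_left (div_nonneg (cutWeight_nonneg S) (setWeight_pos hH hS).le)

/-- A set and its complement have the same cut, so the lighter one has the larger conductance. -/
theorem conductance_mul_setWeight_le [Nontrivial V] (hH : ∀ v, 0 < H.vertexWeight v)
    {S : Finset V} (hS : S.Nonempty) (hhalf : 2 * H.setWeight S ≤ H.setWeight Finset.univ) :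
    H.conductance * H.setWeight S ≤ H.cutWeight S := by
  have ha := setWeight_pos hH hS
  have hW := setWeight_add_compl (H := H) S
  have hSu : S ≠ Finset.univ := by
    rintro rfl
    linarith
  have h1 := H.isLeast_conductance.2 ⟨S, hS, hSu, rfl⟩
  have h2 : H.setConductance Sᶜ ≤ H.setConductance S := by
    rw [setConductance, setConductance, cutWeight_compl]
    exact div_le_div_of_nonneg_left (cutWeight_nonneg S) ha (by linarith)
  rw [max_eq_left h2, setConductance] at h1
  exact (le_div_iff₀ ha).1 h1

theorem sq_conductance_mul_le_oscillation [Nontrivial V] (hH : ∀ v, 0 < H.vertexWeight v)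
    {T : Finset V} (hT : 2 * H.setWeight T ≤ H.setWeight Finset.univ) {h : V → ℝ}
    (h0 : ∀ u, 0 ≤ h u) (hhT : ∀ u ∉ T, h u = 0) :
    H.conductance ^ 2 * H.wInner h h ≤ 2 * oscillation H h := by
  have hco := mul_sum_le_of_isoperimetric (φ := H.conductance) (T := T) (fun S hST hS =>
    conductance_mul_setWeight_le hH hS (by linarith [setWeight_mono hH hST])) (fun u => h u ^ 2)
    (fun u => sq_nonneg _) (fun u hu => by rw [hhT u hu]; ring)
  rw [← wInner_self_eq] at hco
  set N := H.wInner h h with hN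
  have hN0 : 0 ≤ N := wInner_self_nonneg hH h
  have hm0 : ∀ e ∈ H.edges, 0 ≤ edgeMin e h := fun e he =>
    le_edgeMin (H.edge_nonempty e he) fun u _ => h0 u
  have h1 : ∑ e ∈ H.edges, H.weight e * (edgeMax e (fun u => h u ^ 2) -
      edgeMin e (fun u => h u ^ 2)) ≤
        ∑ e ∈ H.edges, H.weight e * (edgeMax e h ^ 2 - edgeMin e h ^ 2) := by
    refine Finset.sum_le_sum fun e he => mul_le_mul_of_nonneg_left ?_ (H.weight_pos e he).le
    exact sub_le_sub (edgeMax_le (H.edge_nonempty e he) fun u hu =>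
        pow_le_pow_left₀ (h0 u) (le_edgeMax hu h) 2)
      (le_edgeMin (H.edge_nonempty e he) fun u hu =>
        pow_le_pow_left₀ (hm0 e he) (edgeMin_le hu h) 2)
  -- Cauchy–Schwarz for M² - m² = (M - m)(M + m). Edges with M = m contribute nothing and are
  -- dropped from the second factor: on a singleton edge (M + m)² = 4h² would exceed 2h². Otherwise
  -- two distinct vertices attain M and m, and (M + m)² ≤ 2M² + 2m².
  have hcs := Finset.sum_sq_le_sum_mul_sum_of_sq_le_mul H.edges
    (r := fun e => H.weight e * (edgeMax e h ^ 2 - edgeMin e h ^ 2))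
    (f := fun e => H.weight e * (edgeMax e h - edgeMin e h) ^ 2)
    (g := fun e => H.weight e *
      if edgeMax e h = edgeMin e h then 0 else (edgeMax e h + edgeMin e h) ^ 2)
    (fun e he => mul_nonneg (H.weight_pos e he).le (sq_nonneg _))
    (fun e he => mul_nonneg (H.weight_pos e he).le (by split_ifs <;> positivity))
    (fun e he => by
      split_ifs with heq
      · rw [heq]; exact le_of_eq (by ring)
      · exact le_of_eq (by ring))
  have h2 : ∑ e ∈ H.edges, H.weight e *
      (if edgeMax e h = edgeMin e h then 0 else (edgeMax e h + edgeMin e h) ^ 2) ≤ 2 * N := by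
    have : 2 * N = ∑ e ∈ H.edges, H.weight e * ∑ u ∈ e, 2 * h u ^ 2 := by
      rw [sum_weight_sum_eq, hN, wInner_self_eq, Finset.mul_sum]
      exact Finset.sum_congr rfl fun u _ => by ring
    rw [this]
    refine Finset.sum_le_sum fun e he => mul_le_mul_of_nonneg_left ?_ (H.weight_pos e he).le
    split_ifs with heq
    · exact Finset.sum_nonneg fun u _ => by positivity
    · obtain ⟨s, hs, hs'⟩ := exists_eq_edgeMax (H.edge_nonempty e he) h
      obtain ⟨i, hi, hi'⟩ := exists_eq_edgeMin (H.edge_nonempty e he) h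
      have hsi : s ≠ i := fun hsi => heq (by rw [← hs', ← hi', hsi])
      have h3 : ∑ u ∈ {s, i}, 2 * h u ^ 2 ≤ ∑ u ∈ e, 2 * h u ^ 2 :=
        Finset.sum_le_sum_of_subset_of_nonneg (by
          intro u hu
          rcases Finset.mem_insert.1 hu with rfl | hu
          · exact hs
          · rwa [Finset.mem_singleton.1 hu]) fun u _ _ => by positivity
      rw [Finset.sum_pair hsi] at h3
      rw [← hs', ← hi']
      nlinarith [sq_nonneg (h s - h i)]
  have hφ0 := conductance_nonneg hH
  have h3 : (H.conductance * N) ^ 2 ≤ oscillation H h * (2 * N) := by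
    refine (pow_le_pow_left₀ (mul_nonneg hφ0 hN0) (hco.trans h1) 2).trans (hcs.trans ?_)
    exact mul_le_mul_of_nonneg_left h2 (oscillation_nonneg h)
  rcases hN0.eq_or_lt with h4 | h4
  · rw [← h4, mul_zero]
    exact mul_nonneg two_pos.le (oscillation_nonneg h)
  · refine le_of_mul_le_mul_right ?_ h4
    linarith

/-- A weighted median. -/
theorem exists_median [Nonempty V] (hH : ∀ v, 0 < H.vertexWeight v) (f : V → ℝ) :
    ∃ c, 2 * H.setWeight {u | c < f u} ≤ H.setWeight Finset.univ ∧
      2 * H.setWeight {u | f u < c} ≤ H.setWeight Finset.univ := by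
  -- The median is the least value of f with at most half of the weight strictly above it. If more
  -- than half lay strictly below, the next smaller value would also qualify.
  let A : Finset V := {u | 2 * H.setWeight {v | f u < f v} ≤ H.setWeight Finset.univ}
  have hA : A.Nonempty := by
    obtain ⟨u, -, hu⟩ := Finset.exists_max_image Finset.univ f Finset.univ_nonempty
    refine ⟨u, Finset.mem_filter.2 ⟨Finset.mem_univ u, ?_⟩⟩
    have : (Finset.univ.filter fun v => f u < f v) = ∅ :=
      Finset.filter_eq_empty_iff.2 fun v _ => not_lt.2 (hu v (Finset.mem_univ v))
    rw [this]
    simpa [setWeight] using Finset.sum_nonneg fun v _ => (hH v).le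
  obtain ⟨u, huA, hu⟩ := Finset.exists_min_image A f hA
  refine ⟨f u, (Finset.mem_filter.1 huA).2, ?_⟩
  by_contra! hlt
  set B : Finset V := {v | f v < f u} with hB
  have hBne : B.Nonempty := by
    rw [Finset.nonempty_iff_ne_empty]
    intro h0
    rw [h0] at hlt
    have : 0 ≤ H.setWeight Finset.univ := Finset.sum_nonneg fun v _ => (hH v).le
    simp only [setWeight, Finset.sum_empty, mul_zero] at hlt this
    linarith
  obtain ⟨v, hvB, hv⟩ := Finset.exists_max_image B f hBne
  have hvA : v ∈ A := by
    refine Finset.mem_filter.2 ⟨Finset.mem_univ v, ?_⟩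
    have hsub : (Finset.univ.filter fun z => f v < f z) ⊆ Bᶜ := by
      intro z hz
      rw [Finset.mem_compl]
      exact fun hzB => absurd (hv z hzB) (not_le.2 (Finset.mem_filter.1 hz).2)
    have h1 := setWeight_mono hH hsub
    have h2 := setWeight_add_compl (H := H) B
    linarith
  exact absurd (hu v hvA) (not_le.2 (Finset.mem_filter.1 hvB).2)

/-- If c lies between m and M, then (M - c)² + (c - m)² ≤ (M - m)²; otherwise one part is zero on
the edge and the other has oscillation M - m. -/
theorem oscillation_posPart_add_negPart_le (f : V → ℝ) (c : ℝ) :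
    oscillation H (fun u => max (f u - c) 0) + oscillation H (fun u => max (c - f u) 0) ≤
      oscillation H f := by
  rw [oscillation, oscillation, oscillation, ← Finset.sum_add_distrib]
  refine Finset.sum_le_sum fun e he => ?_
  rw [← mul_add]
  refine mul_le_mul_of_nonneg_left ?_ (H.weight_pos e he).le
  have hne := H.edge_nonempty e he
  have h1 : edgeMax e (fun u => max (f u - c) 0) ≤ max (edgeMax e f - c) 0 :=
    edgeMax_le hne fun u hu => max_le_max_right 0 (by linarith [le_edgeMax hu f])
  have h2 : max (edgeMin e f - c) 0 ≤ edgeMin e (fun u => max (f u - c) 0) :=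
    le_edgeMin hne fun u hu => max_le_max_right 0 (by linarith [edgeMin_le hu f])
  have h3 : edgeMax e (fun u => max (c - f u) 0) ≤ max (c - edgeMin e f) 0 :=
    edgeMax_le hne fun u hu => max_le_max_right 0 (by linarith [edgeMin_le hu f])
  have h4 : max (c - edgeMax e f) 0 ≤ edgeMin e (fun u => max (c - f u) 0) :=
    le_edgeMin hne fun u hu => max_le_max_right 0 (by linarith [le_edgeMax hu f])
  have h5 := pow_le_pow_left₀ (sub_nonneg.2 (edgeMin_le_edgeMax e fun u => max (f u - c) 0))
    (sub_le_sub h1 h2) 2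
  have h6 := pow_le_pow_left₀ (sub_nonneg.2 (edgeMin_le_edgeMax e fun u => max (c - f u) 0))
    (sub_le_sub h3 h4) 2
  refine (add_le_add h5 h6).trans ?_
  have hmM := edgeMin_le_edgeMax e f
  set M := edgeMax e f
  set m := edgeMin e f
  rcases le_total M c with hM | hM
  · rw [max_eq_right (show M - c ≤ 0 by linarith), max_eq_right (show m - c ≤ 0 by linarith),
      max_eq_left (show 0 ≤ c - m by linarith), max_eq_left (show 0 ≤ c - M by linarith)]
    nlinarith
  · rw [max_eq_left (show 0 ≤ M - c by linarith), max_eq_right (show c - M ≤ 0 by linarith)]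
    rcases le_total m c with hm | hm
    · rw [max_eq_right (show m - c ≤ 0 by linarith), max_eq_left (show 0 ≤ c - m by linarith)]
      nlinarith [mul_nonneg (sub_nonneg.2 hM) (sub_nonneg.2 hm)]
    · rw [max_eq_left (show 0 ≤ m - c by linarith), max_eq_right (show c - m ≤ 0 by linarith)]
      nlinarith

/-- The hard half of Cheeger's inequality. -/
theorem sq_conductance_mul_le_energy [Nontrivial V] (hH : ∀ v, 0 < H.vertexWeight v)
    (hβ : IsMediator H β) {f : V → ℝ} (hf : H.wInner f (fun _ => 1) = 0) :
    H.conductance ^ 2 * H.wInner f f ≤ 8 * energy H β f := by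
  obtain ⟨c, hc1, hc2⟩ := exists_median hH f
  have h1 := sq_conductance_mul_le_oscillation hH hc1 (h := fun u => max (f u - c) 0)
    (fun u => le_max_right _ _) (fun u hu => max_eq_right (by
      simpa using hu))
  have h2 := sq_conductance_mul_le_oscillation hH hc2 (h := fun u => max (c - f u) 0)
    (fun u => le_max_right _ _) (fun u hu => max_eq_right (by
      simpa using hu))
  have h3 := oscillation_posPart_add_negPart_le (H := H) f c
  have h4 := (energy_bounds hβ f).1
  rw [← oscillation] at h4
  -- Since f is orthogonal to 1, shifting it by c only adds c² w(V) to the squared norm.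
  have h5 : H.wInner f f ≤ H.wInner (fun u => max (f u - c) 0) (fun u => max (f u - c) 0) +
      H.wInner (fun u => max (c - f u) 0) (fun u => max (c - f u) 0) := by
    have e1 : H.wInner (fun u => max (f u - c) 0) (fun u => max (f u - c) 0) +
        H.wInner (fun u => max (c - f u) 0) (fun u => max (c - f u) 0) =
          H.wInner (f - c • fun _ => (1 : ℝ)) (f - c • fun _ => (1 : ℝ)) := by
      rw [wInner_self_eq, wInner_self_eq, wInner_self_eq, ← Finset.sum_add_distrib]
      refine Finset.sum_congr rfl fun u _ => ?_
      simp only [Pi.sub_apply, Pi.smul_apply, smul_eq_mul, mul_one]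
      rcases le_total (f u) c with h | h
      · rw [max_eq_right (show f u - c ≤ 0 by linarith), max_eq_left (show 0 ≤ c - f u by linarith)]
        ring
      · rw [max_eq_left (show 0 ≤ f u - c by linarith), max_eq_right (show c - f u ≤ 0 by linarith)]
        ring
    rw [e1]
    simp only [wInner_sub_left, wInner_sub_right, wInner_smul_left, wInner_smul_right, hf,
      H.wInner_comm (fun _ => 1) f]
    nlinarith [mul_nonneg (sq_nonneg c) (wInner_one_one_pos hH).le]
  have h6 := mul_le_mul_of_nonneg_left h5 (sq_nonneg H.conductance)
  linarith

end MediatorDiffusion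

/-! ### Transfer to Euclidean space and proof of the theorem. -/

namespace MediatorDiffusion

open WeightedHypergraph SubgradientFlow RealInnerProductSpace

variable {V : Type*} [Fintype V] [DecidableEq V] {H : WeightedHypergraph V}
  {β : Finset V → Option V → ℝ}

/-- The map `f ↦ (√w_u f_u)_u`, which turns the weighted inner product into the Euclidean one. -/
noncomputable def weightedEquiv (hH : ∀ v, 0 < H.vertexWeight v) :
    (V → ℝ) ≃L[ℝ] EuclideanSpace ℝ V :=
  ((LinearEquiv.piCongrRight fun u => LinearEquiv.smulOfNeZero ℝ ℝ (√(H.vertexWeight u))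
    (Real.sqrt_pos.2 (hH u)).ne').trans (WithLp.linearEquiv 2 ℝ (V → ℝ)).symm).toContinuousLinearEquiv

theorem inner_weightedEquiv (hH : ∀ v, 0 < H.vertexWeight v) (f g : V → ℝ) :
    ⟪weightedEquiv hH f, weightedEquiv hH g⟫ = H.wInner f g := by
  rw [PiLp.inner_apply, wInner]
  refine Finset.sum_congr rfl fun u _ => ?_
  have h : ∀ f : V → ℝ, weightedEquiv hH f u = √(H.vertexWeight u) * f u := fun f => rfl
  rw [h, h, RCLike.inner_apply, conj_trivial]
  linear_combination f u * g u * Real.mul_self_sqrt (hH u).le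

theorem norm_sq_weightedEquiv (hH : ∀ v, 0 < H.vertexWeight v) (f : V → ℝ) :
    ‖weightedEquiv hH f‖ ^ 2 = H.wInner f f := by
  rw [← real_inner_self_eq_norm_sq, inner_weightedEquiv]

theorem isSubgradient_weightedEquiv (hH : ∀ v, 0 < H.vertexWeight v) {f z : V → ℝ} :
    IsSubgradient (fun y => energy H β ((weightedEquiv hH).symm y)) (weightedEquiv hH f)
      (weightedEquiv hH z) ↔
        ∀ g, energy H β f + H.wInner z (g - f) ≤ energy H β g := by
  rw [IsSubgradient, (weightedEquiv hH).surjective.forall]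
  simp only [ContinuousLinearEquiv.symm_apply_apply, ← map_sub, inner_weightedEquiv]

theorem IsDiffusionProcess.isSubgradientCurve (hH : ∀ v, 0 < H.vertexWeight v)
    (hβ : IsMediator H β) {F : ℝ → V → ℝ} (hF : IsDiffusionProcess H β F) :
    IsSubgradientCurve (fun y => energy H β ((weightedEquiv hH).symm y))
      fun t => weightedEquiv hH (F t) where
  continuousOn := (weightedEquiv hH).continuous.comp_continuousOn hF.continuousOn
  deriv t ht := by
    obtain ⟨r, x, hr, hx⟩ := hF.rules t ht
    refine ⟨weightedEquiv hH (-r), ?_, (isSubgradient_weightedEquiv hH).2 (hx.energy_add_le hβ)⟩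
    rw [map_neg, neg_neg]
    exact (weightedEquiv hH).hasFDerivAt.comp_hasDerivWithinAt t hr

/-- Processes are only required to obey the plain rules; that makes them subgradient curves, and the
EVI then forces their derivative to be the shortest choice. -/
theorem isDiffusionOperator_of_rules (hH : ∀ v, 0 < H.vertexWeight v) (hβ : IsMediator H β)
    {r : (V → ℝ) → V → ℝ} {x : (V → ℝ) → Finset V → Option V → V → ℝ}
    (hr : ∀ f, Rules H β f (r f) (x f)) (hfo : ∀ f, FirstOrderRules H f (r f) (x f)) :
    IsDiffusionOperator H β fun f => -r f := by
  set Φ := weightedEquiv hH with hΦ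
  let Q : EuclideanSpace ℝ V → ℝ := fun y => energy H β (Φ.symm y)
  let L : EuclideanSpace ℝ V → EuclideanSpace ℝ V := fun y => Φ (-r (Φ.symm y))
  have hQ : Continuous Q := continuous_energy.comp Φ.symm.continuous
  have hsub : ∀ y, IsSubgradient Q y (L y) := Φ.surjective.forall.2 fun f => by
    simp only [L, ContinuousLinearEquiv.symm_apply_apply]
    exact (isSubgradient_weightedEquiv hH).2 ((hr f).energy_add_le hβ)
  have hmin : ∀ y z, IsSubgradient Q y z → ‖z‖ ≤ ‖L y‖ → z = L y :=
    Φ.surjective.forall.2 fun f => Φ.surjective.forall.2 fun z hz hle => by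
      simp only [L, ContinuousLinearEquiv.symm_apply_apply] at hle ⊢
      rw [← sq_le_sq₀ (norm_nonneg _) (norm_nonneg _), norm_sq_weightedEquiv,
        norm_sq_weightedEquiv, wInner_neg_left, wInner_neg_right, neg_neg] at hle
      rw [eq_neg_of_subgradient hH hβ (hr f) (hfo f) ((isSubgradient_weightedEquiv hH).1 hz) hle]
  have hgrowth : ∀ y, ‖L y‖ ≤ 4 * 2 * ‖y‖ := fun y =>
    (hsub y).norm_le two_pos (fun y => energy_nonneg hβ _)
      (Φ.surjective.forall.2 fun g => by
        rw [hΦ, norm_sq_weightedEquiv]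
        simpa [Q, hΦ] using energy_le hβ g)
  refine ⟨fun f₀ => ?_, fun F G hF hG h0 t ht => ?_, fun F hF t ht => ?_, fun f s => ?_⟩
  · obtain ⟨F, h0, hc, hF⟩ := exists_isSubgradientCurve hQ hsub hmin (by norm_num) hgrowth (Φ f₀)
    refine ⟨fun t => Φ.symm (F t), ⟨Φ.symm.continuous.comp_continuousOn hc, fun t ht => ?_⟩,
      by simp [h0]⟩
    refine ⟨r (Φ.symm (F t)), x (Φ.symm (F t)), ?_, hr _⟩
    have h := Φ.symm.hasFDerivAt.comp_hasDerivWithinAt t (hF t ht)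
    simpa [L, Function.comp_def] using h
  · exact Φ.injective ((hF.isSubgradientCurve hH hβ).unique (hG.isSubgradientCurve hH hβ)
      (by rw [h0]) ht)
  · have hcurve := hF.isSubgradientCurve hH hβ
    have h := hcurve.satisfiesEVI.hasDerivWithinAt hcurve.continuousOn hsub hmin ht
    have h' := Φ.symm.hasFDerivAt.comp_hasDerivWithinAt t h
    simpa [L, hΦ, Function.comp_def] using h'
  · constructor
    · rintro ⟨y, hy, hyfo⟩
      rw [firstOrderRules_unique hH (hr f) (hfo f) hy hyfo]
    · intro h
      obtain rfl := neg_injective h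
      exact ⟨x f, hr f, hfo f⟩

end MediatorDiffusion

open MediatorDiffusion in
theorem theorem1 {V : Type*} [Fintype V] [DecidableEq V] [Nontrivial V]
    (H : WeightedHypergraph V) (hH : ∀ v, 0 < H.vertexWeight v)
    (β : Finset V → Option V → ℝ) (hβ : IsMediator H β) :
    ∃ L : (V → ℝ) → (V → ℝ), IsDiffusionOperator H β L ∧
      ∃ γ₂ : ℝ, IsSecondEigenvalue L γ₂ ∧
        IsLeast {q | ∃ f : V → ℝ, f ≠ 0 ∧ H.wInner f (fun _ => 1) = 0 ∧ q = H.rayleigh L f} γ₂ ∧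
        γ₂ / 2 ≤ H.conductance ∧ H.conductance ≤ 2 * √γ₂ := by
  choose r x hr hfo using exists_rules_firstOrderRules hH hβ
  have hL := isDiffusionOperator_of_rules hH hβ hr hfo
  have hray : ∀ f, H.rayleigh (fun f => -r f) f = 2 * energy H β f / H.wInner f f := fun f => by
    rw [WeightedHypergraph.rayleigh, H.wInner_comm f, (hr f).wInner_neg_self]
  have hpos : ∀ f : V → ℝ, f ≠ 0 → 0 < H.wInner f f := fun f hf =>
    lt_of_le_of_ne (WeightedHypergraph.wInner_self_nonneg hH f)
      fun h => hf ((WeightedHypergraph.wInner_self_eq_zero hH).1 h.symm)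
  obtain ⟨f, hf0, hf1, hmin⟩ := exists_energy_minimizer (β := β) hH
  set γ := 2 * energy H β f / H.wInner f f with hγ
  have hγ0 : 0 ≤ γ := div_nonneg (mul_nonneg two_pos.le (energy_nonneg hβ f)) (hpos f hf0).le
  have hfγ : 2 * energy H β f = γ * H.wInner f f := (div_mul_cancel₀ _ (hpos f hf0).ne').symm
  have heig : ∀ c g, IsEigenpair (fun f => -r f) c g → 2 * energy H β g = c * H.wInner g g := by
    rintro c g ⟨-, hg : -r g = c • g⟩
    rw [← (hr g).wInner_neg_self, hg, H.wInner_smul_left]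
  refine ⟨fun f => -r f, hL, γ, ⟨?_, fun c g hg => ?_, ?_, ?_⟩, ⟨?_, ?_⟩,
    half_le_conductance hH hβ hγ0 hmin, ?_⟩
  · obtain ⟨v⟩ := (inferInstance : Nonempty V)
    refine ⟨fun h => one_ne_zero (congrFun h v), ?_⟩
    have h := rules_zero_of_const H β 1
    exact ((hL.firstOrder _ _).1 ⟨_, h.1, h.2⟩).trans (by rw [neg_zero, zero_smul])
  · have h := heig c g hg
    have h1 := energy_nonneg hβ g
    exact nonneg_of_mul_nonneg_left (by linarith) (hpos g hg.1)
  · refine ⟨f, ⟨hf0, ?_⟩, fun a ha => ?_⟩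
    · simp only
      rw [eq_neg_smul_of_minimizer hH hβ hmin (hr f) (hfo f) hf1 hfγ, neg_neg]
    · have ha' : f = a • fun _ => (1 : ℝ) := by ext u; simp [ha]
      rw [ha', H.wInner_smul_left] at hf1
      rcases mul_eq_zero.1 hf1 with h | h
      · exact hf0 (by rw [ha', h, zero_smul])
      · exact (wInner_one_one_pos hH).ne' h
  · rintro c ⟨g, hg, hgc⟩
    have h := heig c g hg
    -- By conservation of mass an eigenvector is orthogonal to 1 or has eigenvalue 0. In the latter
    -- case its nonzero centred part has zero energy, which forces γ ≤ 0.
    have h1 : c * H.wInner g (fun _ => 1) = 0 := by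
      rw [← H.wInner_smul_left, ← show -r g = c • g from hg.2, H.wInner_neg_left, (hr g).wInner_one hβ, neg_zero]
    rcases mul_eq_zero.1 h1 with hc | hg1
    · have hW := wInner_one_one_pos hH
      have h2 := le_energy_of_forall_orthogonal hH hmin g
      set m := H.wInner g (fun _ => 1) / H.wInner (fun _ => 1) (fun _ => 1) with hm
      have h3 := hmin (fun u => g u + -m) (by
        have : (fun u => g u + -m) = g - m • fun _ => (1 : ℝ) := by ext u; simp [sub_eq_add_neg]
        rw [this, H.wInner_sub_left, H.wInner_smul_left, hm, div_mul_cancel₀ _ hW.ne', sub_self])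
      rw [energy_add_const, h, hc, zero_mul] at h3
      rw [hc]
      have h4 : (fun u => g u + -m) ≠ 0 := fun h0 => hgc m (by
        ext u
        have := congrFun h0 u
        simp only [Pi.zero_apply] at this
        linarith)
      exact nonpos_of_mul_nonpos_left h3 (hpos _ h4)
    · have h2 := hmin g hg1
      rw [h] at h2
      exact le_of_mul_le_mul_right h2 (hpos g hg.1)
  · exact ⟨f, hf0, hf1, (hray f).symm⟩
  · rintro q ⟨g, hg0, hg1, rfl⟩
    rw [hray, le_div_iff₀ (hpos g hg0)]
    exact hmin g hg1
  · have h := sq_conductance_mul_le_energy hH hβ hf1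
    have h1 : H.conductance ^ 2 ≤ 4 * γ := by
      refine le_of_mul_le_mul_right ?_ (hpos f hf0)
      linarith
    have h2 := Real.le_sqrt_of_sq_le h1
    rwa [Real.sqrt_mul (by norm_num), show √(4 : ℝ) = 2 by
      rw [show (4 : ℝ) = 2 ^ 2 by norm_num, Real.sqrt_sq two_pos.le]] at h2
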